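/- Let $G$ be a group (if $G$ is a topological group, its topology plays no role here) and let $\sigma:G\times G\to\mathbb T$ be a normalised 2-cocycle: $\sigma(x,y)\sigma(xy,z)=\sigma(y,z)\sigma(x,yz)$, $\sigma(x,e)=\sigma(e,x)=\sigma(x,x^{-1})=1$ and $\overline{\sigma(x,y)}=\sigma(y^{-1},x^{-1})$. Let $\mathrm{Rep}_\sigma G_d$ be the class of all (not necessarily continuous) unitary $\sigma$-representations $\pi(x)\pi(y)=\sigma(x,y)\pi(xy)$ of $G$ on Hilbert spaces, and let $\mathcal R\subseteq\mathrm{Rep}_\sigma G_d$. A *$\sigma$-group algebra* for $(G,\mathcal R)$ is a C*-algebra $\mathcal L$ with a map $\varphi:G\to UM(\mathcal L)$ into the unitaries of its multiplier algebra such that $\varphi(g)\varphi(h)=\sigma(g,h)\varphi(gh)$ and such that the map $\theta:\mathrm{Rep}\,\mathcal L\to\mathrm{Rep}_\sigma G_d$ is injective with image $\mathcal R$. Here $\mathrm{Rep}\,\mathcal L$ is the class of nondegenerate representations of $\mathcal L$ on Hilbert spaces, and $\theta(\pi)$, on the same Hilbert space as $\pi$, is $\varphi$ followed by the unique extension of $\pi$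 to $M(\mathcal L)$, i.e. $\theta(\pi)(g)\,\pi(A)\psi=\pi(\varphi(g)A)\psi$. Let $C^*_\sigma(G_d)$ be the twisted group C*-algebra of the discrete group $G_d$, that is, the completion of the *-algebra of finite sums $\sum_x a_x\delta_x$, with $\delta_x\delta_y=\sigma(x,y)\delta_{xy}$ and $\delta_x^*=\delta_{x^{-1}}$, in the norm $\|a\|=\sup\{\|\sum_x a_x\pi(x)\| : \pi\in\mathrm{Rep}_\sigma G_d\}$. Let $B_\sigma(\mathcal R)$ be the linear space spanned by the coefficient functions $f(x)=(\psi,\pi(x)\xi)$ with $\pi\in\mathcal R$ and $\psi,\xi\in\mathcal H_\pi$ (if $\mathcal R$ is closed under direct sums these already form a linear space). Each such $f$ defines a bounded functional $\sum_x a_x\delta_x\mapsto\sum_x a_xf(x)$ on $C^*_\sigma(G_d)$, whose norm is denoted $\|f\|_*$; let $J_\sigma(\mathcal R)$ be the completion of $B_\sigma(\mathcal R)$ in $\|\cdot\|_*$, that is, its closure in $C^*_\sigma(G_d)^*$. For $\omega\in J_\sigma(\mathcal R)^*$ and $f\in J_\sigma(\mathcal R)$ the functions $f^*(x)=\overline{f(x^{-1})}$,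 $(\lambda_xf)(y)=\sigma(x,y)f(xy)$ and $f^\omega(x)=\omega(\lambda_xf)$ belong to $J_\sigma(\mathcal R)$. The Banach space dual $J_\sigma(\mathcal R)^*$ is given the convolution $(\omega*\xi)(f)=\omega(f^\xi)$ and the involution $\omega^*(f)=\overline{\omega(f^*)}$; let $\delta_x(f)=f(x)$. **Theorem 3.5.** Let $\mathcal L$ be a $\sigma$-group algebra for $(G,\mathcal R)$ with associated map $\varphi:G\to UM(\mathcal L)$. Then there is an injective unital *-homomorphism $\Psi:M(\mathcal L)\to J_\sigma(\mathcal R)^*$ such that $\Psi(\varphi(x))=\delta_x$ for all $x\in G$ and $\|\Psi(A)\|=\|A\|$ for all $A\in\mathcal L$. In particular $\Psi$ embeds $\mathcal L$ isometrically in the convolution algebra $J_\sigma(\mathcal R)^*$. -/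

import Mathlib

open scoped MultiplierAlgebra ComplexConjugate

universe u

noncomputable section

namespace SigmaGroup

/-- A normalised `𝕋`-valued 2-cocycle on `G`. -/
structure NormalizedCocycle (G : Type u) [Group G] where
  /-- the underlying function `σ(x, y)` -/
  toFun : G → G → Circle
  cocycle : ∀ x y z, toFun x y * toFun (x * y) z = toFun y z * toFun x (y * z)
  right_one : ∀ x, toFun x 1 = 1
  one_left : ∀ x, toFun 1 x = 1
  self_inv : ∀ x, toFun x x⁻¹ = 1
  conj_eq : ∀ x y, (starRingEnd ℂ) (toFun x y : ℂ) = (toFun y⁻¹ x⁻¹ : ℂ)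

instance {G : Type u} [Group G] :
    CoeFun (NormalizedCocycle G) (fun _ => G → G → Circle) := ⟨NormalizedCocycle.toFun⟩

variable {G : Type u} [Group G]

/-- A unitary `σ`-representation of the (discrete) group `G` on a Hilbert space `H`. -/
structure SigmaRep (σ : NormalizedCocycle G) (H : Type u) [NormedAddCommGroup H]
    [InnerProductSpace ℂ H] [CompleteSpace H] where
  /-- the unitary operators `π(x)` -/
  toFun : G → unitary (H →L[ℂ] H)
  map_mul : ∀ x y, (toFun x : H →L[ℂ] H) * (toFun y : H →L[ℂ] H) =
    (σ x y : ℂ) • (toFun (x * y) : H →L[ℂ] H)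

/-- A class of unitary `σ`-representations of `G` (no continuity is required), on arbitrary
Hilbert spaces. -/
def RepFamily (σ : NormalizedCocycle G) : Type (u + 1) :=
  ∀ (H : Type u) [NormedAddCommGroup H] [InnerProductSpace ℂ H] [CompleteSpace H],
    Set (SigmaRep σ H)

/-! ### The twisted group algebra of the discrete group and its universal C*-norm -/

/-- The twisted group algebra of finite sums `∑ a_x δ_x`, with product
`δ_x δ_y = σ(x, y) δ_{xy}`. With the norm below, its completion is `C*_σ(G_d)`. -/
def TwAlg (_σ : NormalizedCocycle G) : Type u := G →₀ ℂ

namespace TwAlg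

variable {σ : NormalizedCocycle G}

instance : AddCommGroup (TwAlg σ) := inferInstanceAs (AddCommGroup (G →₀ ℂ))
instance : Module ℂ (TwAlg σ) := inferInstanceAs (Module ℂ (G →₀ ℂ))

/-- The generator `δ_x`. -/
def gen (σ : NormalizedCocycle G) (x : G) : TwAlg σ := Finsupp.single x (1 : ℂ)

theorem induction_on {p : TwAlg σ → Prop} (a : TwAlg σ) (h0 : p 0)
    (hadd : ∀ a b, p a → p b → p (a + b)) (hs : ∀ (r : ℂ) x, p (r • gen σ x)) : p a := by
  refine Finsupp.induction_linear (motive := p) a h0 hadd (fun x r => ?_)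
  have : (r • gen σ x : TwAlg σ) = Finsupp.single x r := by
    change r • (Finsupp.single x (1 : ℂ)) = _
    simp
  exact this ▸ hs r x

/-- The linear extension to `TwAlg σ` of a map given on the generators. -/
def lin (σ : NormalizedCocycle G) {M : Type*} [AddCommGroup M] [Module ℂ M] (v : G → M) :
    TwAlg σ →ₗ[ℂ] M :=
  Finsupp.linearCombination ℂ v

@[simp] theorem lin_gen {M : Type*} [AddCommGroup M] [Module ℂ M] (v : G → M) (x : G) :
    lin σ v (gen σ x) = v x := by
  exact (Finsupp.linearCombination_single ℂ (1 : ℂ) x).trans (one_smul ℂ _)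

/-- The bilinear product determined by `δ_x δ_y = σ(x, y) δ_{xy}`. -/
def mulL (σ : NormalizedCocycle G) : TwAlg σ →ₗ[ℂ] TwAlg σ →ₗ[ℂ] TwAlg σ :=
  lin σ fun x => lin σ fun y => (σ x y : ℂ) • gen σ (x * y)

instance : Mul (TwAlg σ) := ⟨fun a b => mulL σ a b⟩

theorem mul_def (a b : TwAlg σ) : a * b = mulL σ a b := rfl

@[simp] theorem gen_mul_gen (x y : G) :
    gen σ x * gen σ y = (σ x y : ℂ) • gen σ (x * y) := by
  simp [mul_def, mulL]

theorem gen_mul_assoc (x y z : G) :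
    mulL σ (mulL σ (gen σ x) (gen σ y)) (gen σ z) =
      mulL σ (gen σ x) (mulL σ (gen σ y) (gen σ z)) := by
  have h := congrArg (fun c : Circle => (c : ℂ)) (σ.cocycle x y z)
  simp only [Circle.coe_mul] at h
  simp only [mulL, lin_gen, map_smul, LinearMap.smul_apply, smul_smul, h, mul_assoc]

instance : NonUnitalRing (TwAlg σ) where
  left_distrib a b c := by simp [mul_def]
  right_distrib a b c := by simp [mul_def]
  zero_mul a := by simp [mul_def]
  mul_zero a := by simp [mul_def]
  mul_assoc a b c := by
    simp only [mul_def]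
    induction a using induction_on with
    | h0 => simp
    | hadd a a' h h' => simp [h, h']
    | hs r x =>
      induction b using induction_on with
      | h0 => simp
      | hadd a a' h h' => simp only [map_add, LinearMap.add_apply, h, h']
      | hs s y =>
        induction c using induction_on with
        | h0 => simp
        | hadd a a' h h' => simp only [map_add, h, h']
        | hs t z => simp only [map_smul, LinearMap.smul_apply, gen_mul_assoc]

instance : IsScalarTower ℂ (TwAlg σ) (TwAlg σ) :=
  ⟨fun r a b => by simp [mul_def, smul_eq_mul]⟩

instance : SMulCommClass ℂ (TwAlg σ) (TwAlg σ) :=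
  ⟨fun r a b => by simp [mul_def, smul_eq_mul]⟩

theorem gen_one_mul (a : TwAlg σ) : gen σ 1 * a = a := by
  induction a using induction_on with
  | h0 => simp
  | hadd a b h h' => simp [mul_add, h, h']
  | hs r x => simp [mul_smul_comm, σ.one_left]

theorem mul_gen_one (a : TwAlg σ) : a * gen σ 1 = a := by
  induction a using induction_on with
  | h0 => simp
  | hadd a b h h' => simp [add_mul, h, h']
  | hs r x => simp [smul_mul_assoc, σ.right_one]

/-- The involution determined by `δ_x* = δ_{x⁻¹}`, i.e. `(∑ a_x δ_x)* = ∑ conj(a_x) δ_{x⁻¹}`. -/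
instance : Star (TwAlg σ) :=
  ⟨fun a => Finsupp.mapRange conj (map_zero _) (Finsupp.equivMapDomain (Equiv.inv G) a)⟩

/-- The coefficient `a_x` of `a = ∑ a_x δ_x`. -/
def coef (a : TwAlg σ) (x : G) : ℂ := Finsupp.toFun a x

theorem star_add' (a b : TwAlg σ) : star (a + b) = star a + star b := by
  refine Finsupp.ext fun x => ?_
  change conj (coef a x⁻¹ + coef b x⁻¹) = _
  rw [map_add]; rfl

theorem star_smul' (r : ℂ) (a : TwAlg σ) : star (r • a) = conj r • star a := by
  refine Finsupp.ext fun x => ?_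
  change conj (r * coef a x⁻¹) = _
  rw [map_mul]; rfl

theorem star_zero' : star (0 : TwAlg σ) = 0 := by
  refine Finsupp.ext fun x => ?_
  change conj (0 : ℂ) = 0
  simp

theorem star_gen (x : G) : star (gen σ x) = gen σ x⁻¹ := by
  classical
  refine Finsupp.ext fun y => ?_
  change conj ((Finsupp.single x (1 : ℂ)) y⁻¹) = (Finsupp.single x⁻¹ (1 : ℂ)) y
  simp only [Finsupp.single_apply]
  by_cases h : x = y⁻¹
  · simp [h]
  · have : x⁻¹ ≠ y := fun h' => h (by simp [← h'])
    simp [h, this]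

end TwAlg

open TwAlg

namespace SigmaRep

variable {σ : NormalizedCocycle G} {H : Type u} [NormedAddCommGroup H] [InnerProductSpace ℂ H]
  [CompleteSpace H]

/-- The extension of a `σ`-representation to finite sums: `π(∑ a_x δ_x) = ∑ a_x π(x)`. -/
def ext (π : SigmaRep σ H) : TwAlg σ →ₗ[ℂ] (H →L[ℂ] H) :=
  lin σ fun x => (π.toFun x : H →L[ℂ] H)

@[simp] theorem ext_gen (π : SigmaRep σ H) (x : G) :
    π.ext (gen σ x) = (π.toFun x : H →L[ℂ] H) := by
  simp [ext]

theorem ext_mul (π : SigmaRep σ H) (a b : TwAlg σ) : π.ext (a * b) = π.ext a * π.ext b := by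
  induction a using TwAlg.induction_on with
  | h0 => simp
  | hadd a a' h h' => simp [add_mul, h, h']
  | hs r x =>
    induction b using TwAlg.induction_on with
    | h0 => simp
    | hadd a a' h h' => simp only [mul_add, map_add, h, h']
    | hs s y => simp [smul_mul_assoc, mul_smul_comm, π.map_mul]

theorem toFun_one (π : SigmaRep σ H) : (π.toFun 1 : H →L[ℂ] H) = 1 := by
  have h := π.map_mul 1 1
  rw [σ.one_left, mul_one, Circle.coe_one, one_smul] at h
  calc (π.toFun 1 : H →L[ℂ] H)
      = star (π.toFun 1 : H →L[ℂ] H) * (π.toFun 1) * (π.toFun 1) := by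
        rw [Unitary.coe_star_mul_self, one_mul]
    _ = 1 := by rw [mul_assoc, h, Unitary.coe_star_mul_self]

theorem toFun_inv (π : SigmaRep σ H) (x : G) :
    (π.toFun x⁻¹ : H →L[ℂ] H) = star (π.toFun x : H →L[ℂ] H) := by
  have h := π.map_mul x x⁻¹
  rw [σ.self_inv, mul_inv_cancel, Circle.coe_one, one_smul, toFun_one] at h
  calc (π.toFun x⁻¹ : H →L[ℂ] H)
      = star (π.toFun x : H →L[ℂ] H) * (π.toFun x) * (π.toFun x⁻¹) := by
        rw [Unitary.coe_star_mul_self, one_mul]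
    _ = _ := by rw [mul_assoc, h, mul_one]

theorem ext_star (π : SigmaRep σ H) (a : TwAlg σ) : π.ext (star a) = star (π.ext a) := by
  induction a using TwAlg.induction_on with
  | h0 => simp [star_zero']
  | hadd a b h h' => simp [star_add', h, h']
  | hs r x => simp [star_smul', star_gen, toFun_inv]

/-- The representation on the zero space. -/
def zeroRep (σ : NormalizedCocycle G) : SigmaRep σ PUnit.{u + 1} where
  toFun _ := 1
  map_mul _ _ := by ext

end SigmaRep

namespace TwAlg

variable {σ : NormalizedCocycle G}

/-- The numbers `‖π(a)‖`, for `π` running over all unitary `σ`-representations of `G`. -/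
def normSet (a : TwAlg σ) : Set ℝ :=
  {r | ∃ (H : Type u) (_ : NormedAddCommGroup H) (_ : InnerProductSpace ℂ H)
    (_ : CompleteSpace H) (π : SigmaRep σ H), r = ‖π.ext a‖}

theorem normSet_nonempty (a : TwAlg σ) : (normSet a).Nonempty :=
  ⟨_, PUnit.{u + 1}, inferInstance, inferInstance, inferInstance, SigmaRep.zeroRep σ, rfl⟩

theorem normSet_bddAbove (a : TwAlg σ) : BddAbove (normSet a) := by
  induction a using TwAlg.induction_on with
  | h0 => exact ⟨0, by rintro _ ⟨H, _, _, _, π, rfl⟩; simp⟩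
  | hadd a b h h' =>
    obtain ⟨C, hC⟩ := h
    obtain ⟨D, hD⟩ := h'
    refine ⟨C + D, ?_⟩
    rintro _ ⟨H, i1, i2, i3, π, rfl⟩
    rw [map_add]
    exact (norm_add_le _ _).trans
      (add_le_add (hC ⟨H, i1, i2, i3, π, rfl⟩) (hD ⟨H, i1, i2, i3, π, rfl⟩))
  | hs r x =>
    refine ⟨‖r‖, ?_⟩
    rintro _ ⟨H, i1, i2, i3, π, rfl⟩
    rw [map_smul, norm_smul, SigmaRep.ext_gen]
    refine mul_le_of_le_one_right (norm_nonneg _) ?_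
    refine ContinuousLinearMap.opNorm_le_bound _ zero_le_one fun v => ?_
    rw [one_mul]
    exact le_of_eq (Unitary.norm_map (π.toFun x) v)

/-- The universal C*-norm: the supremum of `‖π(a)‖` over all unitary `σ`-representations. -/
def unorm (a : TwAlg σ) : ℝ := sSup (normSet a)

theorem norm_ext_le_unorm {H : Type u} [NormedAddCommGroup H] [InnerProductSpace ℂ H]
    [CompleteSpace H] (π : SigmaRep σ H) (a : TwAlg σ) : ‖π.ext a‖ ≤ unorm a :=
  le_csSup (normSet_bddAbove a) ⟨H, _, _, _, π, rfl⟩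

theorem unorm_le {a : TwAlg σ} {C : ℝ}
    (h : ∀ (H : Type u) [NormedAddCommGroup H] [InnerProductSpace ℂ H] [CompleteSpace H]
      (π : SigmaRep σ H), ‖π.ext a‖ ≤ C) : unorm a ≤ C := by
  refine csSup_le (normSet_nonempty a) ?_
  rintro _ ⟨H, _, _, _, π, rfl⟩
  exact h H π

theorem unorm_nonneg (a : TwAlg σ) : 0 ≤ unorm a :=
  (norm_nonneg _).trans (norm_ext_le_unorm (SigmaRep.zeroRep σ) a)

/-- The universal C*-norm as a seminorm. -/
def useminorm (σ : NormalizedCocycle G) : Seminorm ℂ (TwAlg σ) :=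
  Seminorm.ofSMulLE unorm
    (le_antisymm (unorm_le fun H _ _ _ π => by simp) (unorm_nonneg _))
    (fun a b => unorm_le fun H _ _ _ π => by
      rw [map_add]
      exact (norm_add_le _ _).trans
        (add_le_add (norm_ext_le_unorm π a) (norm_ext_le_unorm π b)))
    (fun r a => unorm_le fun H _ _ _ π => by
      rw [map_smul, norm_smul]
      exact mul_le_mul_of_nonneg_left (norm_ext_le_unorm π a) (norm_nonneg r))

instance : SeminormedAddCommGroup (TwAlg σ) :=
  (useminorm σ).toAddGroupSeminorm.toSeminormedAddCommGroup

theorem norm_def (a : TwAlg σ) : ‖a‖ = unorm a := rfl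

theorem norm_ext_le {H : Type u} [NormedAddCommGroup H] [InnerProductSpace ℂ H]
    [CompleteSpace H] (π : SigmaRep σ H) (a : TwAlg σ) : ‖π.ext a‖ ≤ ‖a‖ :=
  norm_ext_le_unorm π a

instance : NormedSpace ℂ (TwAlg σ) where
  norm_smul_le r a := (map_smul_eq_mul (useminorm σ) r a).le

instance : NonUnitalSeminormedRing (TwAlg σ) where
  __ := (inferInstance : SeminormedAddCommGroup (TwAlg σ))
  __ := (inferInstance : NonUnitalRing (TwAlg σ))
  norm_mul_le a b := unorm_le fun H _ _ _ π => by
    rw [SigmaRep.ext_mul]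
    exact (norm_mul_le _ _).trans
      (mul_le_mul (norm_ext_le π a) (norm_ext_le π b) (norm_nonneg _) (norm_nonneg _))

theorem norm_star_le (a : TwAlg σ) : ‖star a‖ ≤ ‖a‖ := unorm_le fun H _ _ _ π => by
  rw [SigmaRep.ext_star, norm_star]
  exact norm_ext_le π a

end TwAlg

/-! ### The function spaces `B_σ(R)` and `J_σ(R)`

A function `f` on `G` in `B_σ` or `J_σ` is identified with the functional `∑ a_x δ_x ↦ ∑ a_x f(x)`
in `C*_σ(G_d)*`, which is the (isometrically same) dual of the dense subalgebra `TwAlg σ`. So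
`f(x)` is the value of the functional at `δ_x = gen σ x`, and `‖f‖_*` is its norm. -/

/-- The dual space `C*_σ(G_d)*` with its norm `‖·‖_*`. -/
abbrev FS (σ : NormalizedCocycle G) : Type u := StrongDual ℂ (TwAlg σ)

variable {σ : NormalizedCocycle G}

instance : NormedAddCommGroup (FS σ) :=
  NormedAddCommGroup.ofSeparation fun f hf => by
    ext a
    have h := f.le_opNorm a
    rw [hf, zero_mul] at h
    exact norm_le_zero_iff.1 h

/-- The coefficient function `x ↦ (ψ, π(x) ξ)`, as an element of `C*_σ(G_d)*`. -/
def coeff {H : Type u} [NormedAddCommGroup H] [InnerProductSpace ℂ H]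
    [CompleteSpace H] (π : SigmaRep σ H) (ψ ξ : H) : FS σ :=
  LinearMap.mkContinuous
    { toFun := fun a => inner ℂ ψ (π.ext a ξ)
      map_add' := fun a b => by simp
      map_smul' := fun r a => by simp }
    (‖ψ‖ * ‖ξ‖)
    (fun a => by
      refine (norm_inner_le_norm ψ (π.ext a ξ)).trans ?_
      have h := (π.ext a).le_of_opNorm_le (norm_ext_le π a) ξ
      calc ‖ψ‖ * ‖π.ext a ξ‖ ≤ ‖ψ‖ * (‖a‖ * ‖ξ‖) := by gcongr
        _ = ‖ψ‖ * ‖ξ‖ * ‖a‖ := by ring)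

section

variable {H : Type u} [NormedAddCommGroup H] [InnerProductSpace ℂ H] [CompleteSpace H]

@[simp] theorem coeff_apply (π : SigmaRep σ H) (ψ ξ : H) (a : TwAlg σ) :
    coeff π ψ ξ a = inner ℂ ψ (π.ext a ξ) := rfl

theorem norm_coeff_le (π : SigmaRep σ H) (ψ ξ : H) : ‖coeff π ψ ξ‖ ≤ ‖ψ‖ * ‖ξ‖ :=
  LinearMap.mkContinuous_norm_le _ (by positivity) _

end

/-- The set of coefficient functions `x ↦ (ψ, π(x) ξ)`, `π ∈ R`, `ψ, ξ ∈ H_π`. -/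
def coeffSet (R : RepFamily σ) : Set (FS σ) :=
  {f | ∃ (H : Type u) (_ : NormedAddCommGroup H) (_ : InnerProductSpace ℂ H)
    (_ : CompleteSpace H) (π : SigmaRep σ H) (ψ ξ : H), π ∈ R H ∧ f = coeff π ψ ξ}

/-- `B_σ(R)`: the linear space of coefficient functions of `R`. (When `R` is closed under direct
sums, `coeffSet R` is already a linear space and taking the span adds nothing.) -/
def B (R : RepFamily σ) : Submodule ℂ (FS σ) := Submodule.span ℂ (coeffSet R)

/-- `J_σ(R)`: the completion of `B_σ(R)` in the norm `‖·‖_*`, realised as the closure of `B_σ(R)`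
in the Banach space `C*_σ(G_d)*`. -/
def J (R : RepFamily σ) : Submodule ℂ (FS σ) := (B R).topologicalClosure

theorem B_le_J (R : RepFamily σ) : B R ≤ J R := Submodule.le_topologicalClosure _

/-- To map `J_σ` into itself it suffices to map coefficient functions into `J_σ`. -/
theorem J_induction {R : RepFamily σ} {E : Type*} [SeminormedAddCommGroup E] [Module ℂ E]
    [ContinuousSMul ℂ E] {τ : ℂ →+* ℂ} (P : Submodule ℂ E) (hP : IsClosed (P : Set E))
    (T : J R →ₛₗ[τ] E) (hT : Continuous T)
    (h : ∀ f (hf : f ∈ coeffSet R), T ⟨f, B_le_J R (Submodule.subset_span hf)⟩ ∈ P)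
    (f : J R) : T f ∈ P := by
  have hB : ∀ f (hf : f ∈ B R), T ⟨f, B_le_J R hf⟩ ∈ P := by
    intro f hf
    induction hf using Submodule.span_induction with
    | mem x hx => exact h x hx
    | zero => exact (map_zero T).symm ▸ P.zero_mem
    | add x y hx hy h1 h2 =>
      have := P.add_mem h1 h2
      rwa [← map_add] at this
    | smul a x hx h1 =>
      have := P.smul_mem (τ a) h1
      rwa [← map_smulₛₗ] at this
  have hd : Dense {g : J R | (g : FS σ) ∈ B R} := by
    intro g
    rw [closure_subtype]
    have : (fun a : J R => (a : FS σ)) '' {g : J R | (g : FS σ) ∈ B R} = (B R : Set (FS σ)) := by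
      ext x
      constructor
      · rintro ⟨y, hy, rfl⟩; exact hy
      · intro hx; exact ⟨⟨x, B_le_J R hx⟩, hx, rfl⟩
    have hg : (g : FS σ) ∈ closure (B R : Set (FS σ)) := g.2
    change (g : FS σ) ∈ closure ((fun a : J R => (a : FS σ)) '' _)
    rw [this]
    exact hg
  have hc : IsClosed {g : J R | T g ∈ P} := hP.preimage hT
  have hsub : {g : J R | (g : FS σ) ∈ B R} ⊆ {g : J R | T g ∈ P} := fun g hg => hB g.1 hg
  have := hc.closure_subset_iff.2 hsub
  exact this (hd f)

/-- Translation: `(lam f a)(b) = f(ab)`. For `a = δ_x` this is the left `σ`-translate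
`(λ_x f)(y) = σ(x, y) f(xy)`, see `lam_gen_gen`. -/
def lam (f : FS σ) : TwAlg σ →L[ℂ] FS σ :=
  (ContinuousLinearMap.compL ℂ (TwAlg σ) (TwAlg σ) ℂ f).comp (ContinuousLinearMap.mul ℂ (TwAlg σ))

@[simp] theorem lam_apply (f : FS σ) (a b : TwAlg σ) : lam f a b = f (a * b) := rfl

theorem lam_gen_gen (f : FS σ) (x y : G) :
    lam f (gen σ x) (gen σ y) = σ x y * f (gen σ (x * y)) := by simp

theorem norm_lam_le (f : FS σ) (a : TwAlg σ) : ‖lam f a‖ ≤ ‖a‖ * ‖f‖ := by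
  refine ContinuousLinearMap.opNorm_le_bound _ (by positivity) fun b => ?_
  rw [lam_apply]
  calc ‖f (a * b)‖ ≤ ‖f‖ * ‖a * b‖ := f.le_opNorm _
    _ ≤ ‖f‖ * (‖a‖ * ‖b‖) := by gcongr; exact norm_mul_le a b
    _ = _ := by ring

theorem lam_coeff {H : Type u} [NormedAddCommGroup H] [InnerProductSpace ℂ H]
    [CompleteSpace H] (π : SigmaRep σ H) (ψ ξ : H) (a : TwAlg σ) :
    lam (coeff π ψ ξ) a = coeff π (star (π.ext a) ψ) ξ := by
  ext b
  simp only [lam_apply, coeff_apply, SigmaRep.ext_mul, ContinuousLinearMap.star_eq_adjoint,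
    ContinuousLinearMap.adjoint_inner_left]
  rfl

theorem lam_mem (R : RepFamily σ) (f : J R) (a : TwAlg σ) : lam (f : FS σ) a ∈ J R := by
  let T : FS σ →L[ℂ] FS σ :=
    (ContinuousLinearMap.compL ℂ (TwAlg σ) (TwAlg σ) ℂ).flip (ContinuousLinearMap.mul ℂ (TwAlg σ) a)
  refine J_induction (J R) (Submodule.isClosed_topologicalClosure _)
    ((T.comp (J R).subtypeL : J R →L[ℂ] FS σ) : J R →ₗ[ℂ] FS σ)
    (T.comp (J R).subtypeL).continuous ?_ f
  rintro _ ⟨H, i1, i2, i3, π, ψ, ξ, hπ, rfl⟩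
  change lam (coeff π ψ ξ) a ∈ J R
  rw [lam_coeff]
  exact B_le_J R (Submodule.subset_span ⟨H, i1, i2, i3, π, _, _, hπ, rfl⟩)

/-! ### The convolution algebra `J_σ(R)*` -/

/-- The Banach space dual `J_σ(R)*`, which carries the convolution product. -/
def JDual (R : RepFamily σ) : Type u := StrongDual ℂ (J R)

namespace JDual

variable {R : RepFamily σ}

instance : NormedAddCommGroup (JDual R) := inferInstanceAs (NormedAddCommGroup (StrongDual ℂ (J R)))
instance : NormedSpace ℂ (JDual R) := inferInstanceAs (NormedSpace ℂ (StrongDual ℂ (J R)))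
instance : FunLike (JDual R) (J R) ℂ := inferInstanceAs (FunLike (StrongDual ℂ (J R)) (J R) ℂ)
instance : ContinuousLinearMapClass (JDual R) ℂ (J R) ℂ :=
  inferInstanceAs (ContinuousLinearMapClass (StrongDual ℂ (J R)) ℂ (J R) ℂ)

@[ext] theorem ext {ω ξ : JDual R} (h : ∀ f, ω f = ξ f) : ω = ξ := DFunLike.ext _ _ h

@[simp] theorem add_apply (ω ξ : JDual R) (f : J R) : (ω + ξ) f = ω f + ξ f := rfl
@[simp] theorem zero_apply (f : J R) : (0 : JDual R) f = 0 := rfl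
@[simp] theorem smul_apply (r : ℂ) (ω : JDual R) (f : J R) : (r • ω) f = r * ω f := rfl

theorem le_norm (ω : JDual R) (f : J R) : ‖ω f‖ ≤ ‖ω‖ * ‖f‖ :=
  ContinuousLinearMap.le_opNorm (show StrongDual ℂ (J R) from ω) f

/-- The function `f^ω(x) = ω(λ_x f)`, as a functional `a ↦ ω(lam f a)`. -/
def transFS (ω : JDual R) (f : J R) : FS σ :=
  (show StrongDual ℂ (J R) from ω).comp ((lam (f : FS σ)).codRestrict (J R) (lam_mem R f))

theorem transFS_apply (ω : JDual R) (f : J R) (a : TwAlg σ) :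
    transFS ω f a = ω ⟨lam (f : FS σ) a, lam_mem R f a⟩ := rfl

theorem norm_transFS_le (ω : JDual R) (f : J R) : ‖transFS ω f‖ ≤ ‖ω‖ * ‖f‖ := by
  refine ContinuousLinearMap.opNorm_le_bound _ (by positivity) fun a => ?_
  rw [transFS_apply, mul_right_comm, mul_assoc]
  exact (le_norm ω _).trans (mul_le_mul_of_nonneg_left (norm_lam_le _ a) (norm_nonneg ω))

/-- The map `f ↦ f^ω` is linear and bounded. -/
def transL (ω : JDual R) : J R →L[ℂ] FS σ :=
  LinearMap.mkContinuous
    { toFun := transFS ω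
      map_add' := fun f g => by
        ext a
        simp only [transFS_apply, _root_.add_apply, ← map_add]
        rfl
      map_smul' := fun r f => by
        ext a
        simp only [transFS_apply, _root_.smul_apply, ← map_smul, RingHom.id_apply]
        rfl }
    ‖ω‖ (norm_transFS_le ω)

theorem exists_riesz (ω : JDual R) {H : Type u} [NormedAddCommGroup H] [InnerProductSpace ℂ H]
    [CompleteSpace H] (π : SigmaRep σ H) (hπ : π ∈ R H) (ξ : H) :
    ∃ v : H, ∀ ψ (h : coeff π ψ ξ ∈ J R), ω ⟨coeff π ψ ξ, h⟩ = inner ℂ ψ v := by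
  have hm : ∀ ψ, coeff π ψ ξ ∈ J R := fun ψ =>
    B_le_J R (Submodule.subset_span ⟨H, _, _, _, π, ψ, ξ, hπ, rfl⟩)
  let T : StrongDual ℂ H := LinearMap.mkContinuous
    { toFun := fun ψ => conj (ω ⟨coeff π ψ ξ, hm ψ⟩)
      map_add' := fun ψ ψ' => by
        rw [← map_add, ← map_add]
        congr 2
        ext a
        simp
      map_smul' := fun r ψ => by
        have : (⟨coeff π (r • ψ) ξ, hm _⟩ : J R) = conj r • ⟨coeff π ψ ξ, hm ψ⟩ := by
          ext a
          simp [mul_comm]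
        rw [this, map_smul, smul_eq_mul, map_mul]
        simp }
    (‖ω‖ * ‖ξ‖) (fun ψ => by
      change ‖conj (ω ⟨coeff π ψ ξ, hm ψ⟩)‖ ≤ _
      rw [RCLike.norm_conj]
      rw [mul_right_comm, mul_assoc]
      exact (le_norm ω _).trans
        (mul_le_mul_of_nonneg_left (norm_coeff_le π ψ ξ) (norm_nonneg ω)))
  refine ⟨(InnerProductSpace.toDual ℂ H).symm T, fun ψ h => ?_⟩
  have h1 : inner ℂ ((InnerProductSpace.toDual ℂ H).symm T) ψ = T ψ :=
    InnerProductSpace.toDual_symm_apply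
  rw [← inner_conj_symm, h1]
  exact (Complex.conj_conj _).symm

theorem transFS_mem (ω : JDual R) (f : J R) : transFS ω f ∈ J R := by
  refine J_induction (J R) (Submodule.isClosed_topologicalClosure _)
    (transL ω : J R →ₗ[ℂ] FS σ) (transL ω).continuous ?_ f
  rintro _ ⟨H, i1, i2, i3, π, ψ, ξ, hπ, rfl⟩
  change transFS ω _ ∈ J R
  obtain ⟨v, hv⟩ := exists_riesz ω π hπ ξ
  have : transFS ω ⟨coeff π ψ ξ, B_le_J R (Submodule.subset_span
      ⟨H, i1, i2, i3, π, ψ, ξ, hπ, rfl⟩)⟩ = coeff π ψ v := by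
    ext a
    rw [transFS_apply]
    have hl := lam_coeff π ψ ξ a
    have hm : coeff π (star (π.ext a) ψ) ξ ∈ J R :=
      B_le_J R (Submodule.subset_span ⟨H, i1, i2, i3, π, _, _, hπ, rfl⟩)
    rw [coeff_apply, show (⟨lam (coeff π ψ ξ) a, _⟩ : J R) = ⟨_, hm⟩ from Subtype.ext hl, hv _ hm,
      ContinuousLinearMap.star_eq_adjoint, ContinuousLinearMap.adjoint_inner_left]
  rw [this]
  exact B_le_J R (Submodule.subset_span ⟨H, i1, i2, i3, π, _, _, hπ, rfl⟩)

/-- The function `f^ω(x) = ω(λ_x f)` as an element of `J_σ(R)`. -/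
def trans (ω : JDual R) (f : J R) : J R := ⟨transFS ω f, transFS_mem ω f⟩

/-- Convolution: `(ω * ξ)(f) = ω(f^ξ)`. -/
instance : Mul (JDual R) :=
  ⟨fun ω ξ => (show StrongDual ℂ (J R) from ω).comp
    ((transL ξ).codRestrict (J R) (transFS_mem ξ))⟩

theorem mul_apply (ω ξ : JDual R) (f : J R) : (ω * ξ) f = ω (trans ξ f) := rfl

/-- The point measure `δ_x(f) = f(x)`. -/
def delta (R : RepFamily σ) (x : G) : JDual R :=
  (ContinuousLinearMap.apply ℂ ℂ (gen σ x)).comp (J R).subtypeL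

@[simp] theorem delta_apply (x : G) (f : J R) : delta R x f = (f : FS σ) (gen σ x) := rfl

instance : One (JDual R) := ⟨delta R 1⟩

theorem one_def : (1 : JDual R) = delta R 1 := rfl

instance : Ring (JDual R) where
  __ := (inferInstance : AddCommGroup (JDual R))
  left_distrib a b c := by
    ext f
    simp only [mul_apply, add_apply, ← map_add]
    rfl
  right_distrib a b c := rfl
  zero_mul a := rfl
  mul_zero a := by
    ext f
    rw [mul_apply, show trans (0 : JDual R) f = 0 from rfl]
    simp
  mul_assoc a b c := by
    ext f
    simp only [mul_apply]
    congr 1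
    refine Subtype.ext (ContinuousLinearMap.ext fun x => ?_)
    change b ⟨lam (transFS c f) x, _⟩ = b (trans c ⟨lam f x, _⟩)
    congr 1
    refine Subtype.ext (ContinuousLinearMap.ext fun y => ?_)
    change c ⟨lam f (x * y), _⟩ = c ⟨lam (lam f x) y, _⟩
    congr 1
    refine Subtype.ext (ContinuousLinearMap.ext fun z => ?_)
    simp [mul_assoc]
  one_mul a := by
    ext f
    rw [mul_apply, one_def, delta_apply]
    change a ⟨lam f (gen σ 1), _⟩ = a f
    congr 1
    refine Subtype.ext (ContinuousLinearMap.ext fun z => ?_)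
    simp [gen_one_mul]
  mul_one a := by
    ext f
    rw [mul_apply]
    congr 1
    refine Subtype.ext (ContinuousLinearMap.ext fun z => ?_)
    change (f : FS σ) (z * gen σ 1) = _
    rw [mul_gen_one]

instance : Algebra ℂ (JDual R) :=
  Algebra.ofModule (fun _ _ _ => rfl) (fun r a b => by
    ext f
    simp only [mul_apply, smul_apply]
    rw [show trans (r • b) f = r • trans b f from rfl, map_smul, smul_eq_mul])

end JDual

/-- The involution `f*(x) = conj (f(x⁻¹))`, i.e. `f*(a) = conj (f(a*))` on functionals. -/
def invol (f : FS σ) : FS σ :=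
  LinearMap.mkContinuous
    { toFun := fun a => conj (f (star a))
      map_add' := fun a b => by rw [TwAlg.star_add', map_add, map_add]
      map_smul' := fun r a => by simp [TwAlg.star_smul'] }
    ‖f‖
    (fun a => by
      change ‖conj (f (star a))‖ ≤ _
      rw [RCLike.norm_conj]
      exact (f.le_opNorm _).trans (by gcongr; exact norm_star_le a))

@[simp] theorem invol_apply (f : FS σ) (a : TwAlg σ) : invol f a = conj (f (star a)) := rfl

theorem invol_gen (f : FS σ) (x : G) : invol f (gen σ x) = conj (f (gen σ x⁻¹)) := by
  rw [invol_apply, star_gen]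

theorem norm_invol_le (f : FS σ) : ‖invol f‖ ≤ ‖f‖ :=
  LinearMap.mkContinuous_norm_le _ (norm_nonneg _) _

/-- `f ↦ f*` as a conjugate linear map. -/
def involL (σ : NormalizedCocycle G) : FS σ →ₗ⋆[ℂ] FS σ where
  toFun := invol
  map_add' f g := by ext a; simp
  map_smul' r f := by ext a; simp

theorem continuous_invol : Continuous (invol : FS σ → FS σ) :=
  AddMonoidHomClass.continuous_of_bound (involL σ) 1 fun f => by
    rw [one_mul]; exact norm_invol_le f

theorem invol_mem (R : RepFamily σ) (f : J R) : invol (f : FS σ) ∈ J R := by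
  refine J_induction (J R) (Submodule.isClosed_topologicalClosure _)
    ((involL σ).comp (J R).subtype) (continuous_invol.comp continuous_subtype_val) ?_ f
  rintro _ ⟨H, i1, i2, i3, π, ψ, ξ, hπ, rfl⟩
  change invol (coeff π ψ ξ) ∈ J R
  have : invol (coeff π ψ ξ) = coeff π ξ ψ := by
    ext a
    rw [invol_apply, coeff_apply, coeff_apply, SigmaRep.ext_star, inner_conj_symm,
      ContinuousLinearMap.star_eq_adjoint, ContinuousLinearMap.adjoint_inner_left]
  rw [this]
  exact B_le_J R (Submodule.subset_span ⟨H, i1, i2, i3, π, _, _, hπ, rfl⟩)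

/-- The involution `ω*(f) = conj (ω(f*))` of `J_σ(R)*`. -/
instance {R : RepFamily σ} : Star (JDual R) :=
  ⟨fun ω => (LinearMap.mkContinuous
    { toFun := fun f => conj (ω ⟨invol (f : FS σ), invol_mem R f⟩)
      map_add' := fun f g => by
        rw [← map_add, ← map_add]
        congr 2
        ext a
        simp
      map_smul' := fun r f => by
        have : (⟨invol ((r • f : J R) : FS σ), invol_mem R _⟩ : J R) =
            conj r • ⟨invol (f : FS σ), invol_mem R f⟩ := by
          ext a
          simp
        rw [this, map_smul, smul_eq_mul, map_mul]
        simp }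
    ‖ω‖ (fun f => by
      change ‖conj (ω ⟨invol (f : FS σ), invol_mem R f⟩)‖ ≤ _
      rw [RCLike.norm_conj]
      refine (JDual.le_norm ω _).trans ?_
      gcongr
      exact norm_invol_le _) : StrongDual ℂ (J R))⟩

theorem JDual.star_apply {R : RepFamily σ} (ω : JDual R) (f : J R) :
    star ω f = conj (ω ⟨invol (f : FS σ), invol_mem R f⟩) := rfl

/-! ### `σ`-group algebras -/

section GroupAlgebra

variable {L : Type u} [NonUnitalCStarAlgebra L]

/-- A representation of a C*-algebra on a Hilbert space is nondegenerate if the vectors `π(A)ψ`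
span a dense subspace. -/
def Nondegenerate {H : Type u} [NormedAddCommGroup H] [InnerProductSpace ℂ H] [CompleteSpace H]
    (π : L →⋆ₙₐ[ℂ] (H →L[ℂ] H)) : Prop :=
  (Submodule.span ℂ {v : H | ∃ (A : L) (ψ : H), π A ψ = v}).topologicalClosure = ⊤

/-- `U = θ(π)`: the `σ`-representation `U` of `G` is obtained from the unique extension of the
nondegenerate representation `π` of `L` to the multiplier algebra by composition with `φ`. It is
determined by `U(g) π(A) ψ = π(φ(g) A) ψ`. -/
def IsTheta (φ : G → unitary 𝓜(ℂ, L)) {H : Type u} [NormedAddCommGroup H] [InnerProductSpace ℂ H]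
    [CompleteSpace H] (π : L →⋆ₙₐ[ℂ] (H →L[ℂ] H)) (U : SigmaRep σ H) : Prop :=
  ∀ (g : G) (A : L) (ψ : H),
    (U.toFun g : H →L[ℂ] H) (π A ψ) = π ((φ g : 𝓜(ℂ, L)).fst A) ψ

/-- The C*-algebra `L` together with `φ : G → UM(L)` is a `σ`-group algebra for `(G, R)`: `φ` is a
`σ`-homomorphism, and `θ : Rep L → Rep_σ G_d` is injective with image `R`. -/
structure IsGroupAlgebra (R : RepFamily σ) (φ : G → unitary 𝓜(ℂ, L)) : Prop where
  map_mul : ∀ g h, (φ g : 𝓜(ℂ, L)) * (φ h : 𝓜(ℂ, L)) = (σ g h : ℂ) • (φ (g * h) : 𝓜(ℂ, L))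
  injective : ∀ (H : Type u) [NormedAddCommGroup H] [InnerProductSpace ℂ H] [CompleteSpace H]
    (π π' : L →⋆ₙₐ[ℂ] (H →L[ℂ] H)) (U : SigmaRep σ H),
    Nondegenerate π → Nondegenerate π' → IsTheta φ π U → IsTheta φ π' U → π = π'
  image : ∀ (H : Type u) [NormedAddCommGroup H] [InnerProductSpace ℂ H] [CompleteSpace H]
    (U : SigmaRep σ H),
    U ∈ R H ↔ ∃ π : L →⋆ₙₐ[ℂ] (H →L[ℂ] H), Nondegenerate π ∧ IsTheta φ π U

end GroupAlgebra

end SigmaGroup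

end

/-! A multiplier `m` should act on a coefficient function of `U = θ(π)` by (ψ, U(·)ξ) ↦ (ψ, π(m)ξ),
where π is extended to M(L). Everything rests on the estimate |(ψ, π(m)ξ)| ≤ ‖m‖ ‖(ψ, U(·)ξ)‖_*,
which makes this value independent of the choice of π, ψ and ξ and lets it extend to J_σ(R).

The estimate is a Kaplansky density argument. If a unitary W commutes with θ(π), then Wπ(·)W* has
the same image under θ, so injectivity of θ makes W commute with π(L) and hence with π(M(L)). Thus
closed θ(π)-invariant subspaces are invariant under π(M(L)), and the span of θ(π) approximates π(m)
strong-* (`exists_approx`). Since ‖·‖_* is dual to the universal norm, approximants of universal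
norm nearly ‖m‖ are needed. A contraction m is written as 2s(1 + s*s)⁻¹, s is approximated by a
finite sum c, and 2(1 + cc*)⁻¹c is a contraction in every σ-representation. Finite sums do not form
a complete algebra, so this last element is replaced by the polynomial approximations `iter c n`.

The class R is closed under direct sums because it is the range of θ, so the coefficient functions
already form a linear space and the estimate for single coefficients suffices. The algebraic
identities for Ψ are checked on coefficients. The lower bound for the norm on L, and injectivity on
M(L), come from GNS representations: for each A ≠ 0 in L some nondegenerate π has ‖π(A)‖ ≥ ‖A‖. -/

open scoped MultiplierAlgebra ComplexConjugate

noncomputable section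

namespace SigmaGroup

open Filter Topology TwAlg

/-! ### Extension of nondegenerate representations to the multiplier algebra -/

section MultiplierExtension

variable {L : Type u} [NonUnitalCStarAlgebra L] {H : Type u} [NormedAddCommGroup H]
  [InnerProductSpace ℂ H] [CompleteSpace H]

/-- Operators that agree on the vectors `π(A)ψ` of a nondegenerate representation agree. -/
theorem Nondegenerate.clm_ext {π : L →⋆ₙₐ[ℂ] (H →L[ℂ] H)} (hπ : Nondegenerate π)
    {S T : H →L[ℂ] H} (h : ∀ A ψ, S (π A ψ) = T (π A ψ)) : S = T := by
  refine ContinuousLinearMap.ext_on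
    (s := {v : H | ∃ (A : L) (ψ : H), π A ψ = v}) ?_ ?_
  · exact Submodule.dense_iff_topologicalClosure_eq_top.2 hπ
  · rintro _ ⟨A, ψ, rfl⟩
    exact h A ψ

/-- The linear map `A ⊗ ψ ↦ π(m A)ψ`. -/
def tensorEval (π : L →⋆ₙₐ[ℂ] (H →L[ℂ] H)) (m : 𝓜(ℂ, L)) : TensorProduct ℂ L H →ₗ[ℂ] H :=
  TensorProduct.lift (LinearMap.mk₂ ℂ (fun A ψ => π (m.fst A) ψ)
    (fun A B ψ => by simp) (fun r A ψ => by simp) (fun A ψ ξ => by simp) (fun r A ψ => by simp))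

@[simp] theorem tensorEval_tmul (π : L →⋆ₙₐ[ℂ] (H →L[ℂ] H)) (m : 𝓜(ℂ, L)) (A : L) (ψ : H) :
    tensorEval π m (A ⊗ₜ ψ) = π (m.fst A) ψ := by
  simp [tensorEval]

theorem denseRange_tensorEval_one {π : L →⋆ₙₐ[ℂ] (H →L[ℂ] H)} (hπ : Nondegenerate π) :
    DenseRange (tensorEval π 1) := by
  have h : (Submodule.span ℂ {v : H | ∃ (A : L) (ψ : H), π A ψ = v}) ≤
      LinearMap.range (tensorEval π 1) := by
    refine Submodule.span_le.2 ?_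
    rintro _ ⟨A, ψ, rfl⟩
    exact ⟨A ⊗ₜ ψ, by simp⟩
  exact (Submodule.dense_iff_topologicalClosure_eq_top.2 hπ).mono h

/-- By the centrality relation both sides have the same product with every x on the left, and only 0
is killed by all left multiplications, since y*y = 0 forces y = 0. -/
theorem fst_mul (m : 𝓜(ℂ, L)) (A B : L) : m.fst (A * B) = m.fst A * B := by
  have h : ∀ x, x * (m.fst (A * B) - m.fst A * B) = 0 := fun x => by
    rw [mul_sub, ← m.central, ← mul_assoc, ← mul_assoc, m.central, sub_self]
  exact sub_eq_zero.1 (CStarRing.star_mul_self_eq_zero_iff _ |>.1 (h _))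

/-- For an approximate unit e, π(mA)ψ is the limit of π(me)π(A)ψ, and ‖me‖ ≤ ‖m‖ eventually. This
boundedness is what lets π(A)ψ ↦ π(mA)ψ extend to all of H. -/
theorem norm_tensorEval_le (π : L →⋆ₙₐ[ℂ] (H →L[ℂ] H)) (m : 𝓜(ℂ, L))
    (x : TensorProduct ℂ L H) : ‖tensorEval π m x‖ ≤ ‖m‖ * ‖tensorEval π 1 x‖ := by
  let _ : PartialOrder L := CStarAlgebra.spectralOrder L
  have _ : StarOrderedRing L := CStarAlgebra.spectralOrderedRing L
  have hl := CStarAlgebra.increasingApproximateUnit (A := L)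
  have hcont : ∀ ψ : H, Continuous fun A : L => π A ψ := fun ψ =>
    (ContinuousLinearMap.apply ℂ H ψ).continuous.comp (map_continuous π)
  have hlim : Tendsto (fun e => π (m.fst e) (tensorEval π 1 x)) (CStarAlgebra.approximateUnit L)
      (𝓝 (tensorEval π m x)) := by
    induction x using TensorProduct.induction_on with
    | zero => simp
    | tmul A ψ =>
      have h1 : Tendsto (fun e => e * A) (CStarAlgebra.approximateUnit L) (𝓝 A) :=
        hl.tendsto_mul_right A
      have h2 : Tendsto (fun e => π (m.fst (e * A)) ψ) (CStarAlgebra.approximateUnit L)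
          (𝓝 (π (m.fst A) ψ)) := (((hcont ψ).comp m.fst.continuous).tendsto A).comp h1
      rw [tensorEval_tmul]
      exact h2.congr fun e => by simp [fst_mul]
    | add x y hx hy =>
      simpa only [map_add] using hx.add hy
  refine le_of_tendsto hlim.norm ?_
  filter_upwards [hl.eventually_norm] with e he
  refine ContinuousLinearMap.le_of_opNorm_le _ ?_ _
  refine (NonUnitalStarAlgHom.norm_apply_le π _).trans ?_
  refine (m.fst.le_opNorm e).trans ?_
  rw [DoubleCentralizer.norm_fst]
  exact mul_le_of_le_one_right (norm_nonneg _) he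

/-- The extension to the multiplier algebra of a nondegenerate representation, characterised by
`multExt π m (π(A)ψ) = π(m A)ψ`. -/
def multExt (π : L →⋆ₙₐ[ℂ] (H →L[ℂ] H)) (m : 𝓜(ℂ, L)) : H →L[ℂ] H :=
  (tensorEval π m).extendOfNorm (tensorEval π 1)

namespace Nondegenerate

variable {π : L →⋆ₙₐ[ℂ] (H →L[ℂ] H)}

theorem multExt_apply (hπ : Nondegenerate π) (m : 𝓜(ℂ, L)) (A : L) (ψ : H) :
    multExt π m (π A ψ) = π (m.fst A) ψ := by
  have := LinearMap.extendOfNorm_eq (f := tensorEval π m) (denseRange_tensorEval_one hπ)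
    ⟨‖m‖, norm_tensorEval_le π m⟩ (A ⊗ₜ ψ)
  simpa [multExt] using this

theorem eq_multExt (hπ : Nondegenerate π) {m : 𝓜(ℂ, L)} {T : H →L[ℂ] H}
    (h : ∀ A ψ, T (π A ψ) = π (m.fst A) ψ) : T = multExt π m :=
  hπ.clm_ext fun A ψ => by rw [h, hπ.multExt_apply]

theorem multExt_one (hπ : Nondegenerate π) : multExt π (1 : 𝓜(ℂ, L)) = 1 :=
  (hπ.eq_multExt fun A ψ => by simp).symm

theorem multExt_mul (hπ : Nondegenerate π) (m n : 𝓜(ℂ, L)) : multExt π (m * n) = multExt π m * multExt π n :=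
  (hπ.eq_multExt fun A ψ => by simp [hπ.multExt_apply]).symm

theorem multExt_add (hπ : Nondegenerate π) (m n : 𝓜(ℂ, L)) : multExt π (m + n) = multExt π m + multExt π n :=
  (hπ.eq_multExt fun A ψ => by simp [hπ.multExt_apply]).symm

theorem multExt_smul (hπ : Nondegenerate π) (r : ℂ) (m : 𝓜(ℂ, L)) : multExt π (r • m) = r • multExt π m :=
  (hπ.eq_multExt fun A ψ => by simp [hπ.multExt_apply]).symm

theorem multExt_coe (hπ : Nondegenerate π) (A : L) : multExt π (A : 𝓜(ℂ, L)) = π A :=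
  (hπ.eq_multExt fun B ψ => by simp).symm

theorem multExt_star (hπ : Nondegenerate π) (m : 𝓜(ℂ, L)) : multExt π (star m) = star (multExt π m) := by
  refine (hπ.eq_multExt fun A ψ => ?_).symm
  -- The adjoint relation π(A)*π(m) = π(m*A)* follows from centrality alone; its adjoint is the
  -- claim at π(A)ψ.
  have h : star (π A) * multExt π m = star (π ((star m).fst A)) := by
    refine hπ.clm_ext fun B ξ => ?_
    change star (π A) (multExt π m (π B ξ)) = star (π ((star m).fst A)) (π B ξ)
    rw [hπ.multExt_apply, ← map_star, ← map_star, DoubleCentralizer.star_fst, star_star]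
    change (π (star A) * π (m.fst B)) ξ = (π (m.snd (star A)) * π B) ξ
    rw [← map_mul, ← map_mul, m.central]
  have h' := congrArg star h
  rw [star_mul, star_star, star_star] at h'
  exact congrArg (fun T : H →L[ℂ] H => T ψ) h'

end Nondegenerate

end MultiplierExtension

/-! ### Direct sums of representations -/

section DirectSum

variable {H K : Type u} [NormedAddCommGroup H] [InnerProductSpace ℂ H]
  [NormedAddCommGroup K] [InnerProductSpace ℂ K]

/-- The block diagonal operator `S ⊕ T` on the Hilbert space `H ⊕ K`. -/
def opSum (S : H →L[ℂ] H) (T : K →L[ℂ] K) : WithLp 2 (H × K) →L[ℂ] WithLp 2 (H × K) :=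
  ((WithLp.prodContinuousLinearEquiv 2 ℂ H K).symm : H × K →L[ℂ] WithLp 2 (H × K)) ∘L
    (S.prodMap T) ∘L (WithLp.prodContinuousLinearEquiv 2 ℂ H K : WithLp 2 (H × K) →L[ℂ] H × K)

@[simp] theorem opSum_apply (S : H →L[ℂ] H) (T : K →L[ℂ] K) (x : WithLp 2 (H × K)) :
    opSum S T x = WithLp.toLp 2 (S x.fst, T x.snd) := rfl

variable [CompleteSpace H] [CompleteSpace K]

/-- Block diagonal operators as a *-homomorphism. -/
def opSumHom (H K : Type u) [NormedAddCommGroup H] [InnerProductSpace ℂ H] [CompleteSpace H]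
    [NormedAddCommGroup K] [InnerProductSpace ℂ K] [CompleteSpace K] :
    ((H →L[ℂ] H) × (K →L[ℂ] K)) →⋆ₐ[ℂ] (WithLp 2 (H × K) →L[ℂ] WithLp 2 (H × K)) where
  toFun p := opSum p.1 p.2
  map_one' := rfl
  map_mul' _ _ := rfl
  map_zero' := rfl
  map_add' _ _ := rfl
  commutes' _ := rfl
  map_star' p := by
    refine (ContinuousLinearMap.eq_adjoint_iff _ _).2 fun x y => ?_
    simp [ContinuousLinearMap.star_eq_adjoint, ContinuousLinearMap.adjoint_inner_left]

@[simp] theorem opSumHom_apply (p : (H →L[ℂ] H) × (K →L[ℂ] K)) :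
    opSumHom H K p = opSum p.1 p.2 := rfl

/-- The direct sum of two `σ`-representations. -/
def SigmaRep.sum {G : Type u} [Group G] {σ : NormalizedCocycle G} (U : SigmaRep σ H)
    (V : SigmaRep σ K) : SigmaRep σ (WithLp 2 (H × K)) where
  toFun x := ⟨opSumHom H K (U.toFun x, V.toFun x), Unitary.map_mem _ (by
    rw [Unitary.mem_iff]
    constructor <;> ext1 <;> simp)⟩
  map_mul x y := by
    change opSum ((U.toFun x : H →L[ℂ] H) * (U.toFun y : H →L[ℂ] H))
      ((V.toFun x : K →L[ℂ] K) * (V.toFun y : K →L[ℂ] K)) =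
      opSum ((σ x y : ℂ) • (U.toFun (x * y) : H →L[ℂ] H))
        ((σ x y : ℂ) • (V.toFun (x * y) : K →L[ℂ] K))
    rw [U.map_mul, V.map_mul]

theorem SigmaRep.sum_toFun {G : Type u} [Group G] {σ : NormalizedCocycle G} (U : SigmaRep σ H)
    (V : SigmaRep σ K) (g : G) :
    ((U.sum V).toFun g : WithLp 2 (H × K) →L[ℂ] WithLp 2 (H × K)) =
      opSum (U.toFun g : H →L[ℂ] H) (V.toFun g : K →L[ℂ] K) := rfl

theorem SigmaRep.sum_ext {G : Type u} [Group G] {σ : NormalizedCocycle G} (U : SigmaRep σ H)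
    (V : SigmaRep σ K) (a : TwAlg σ) : (U.sum V).ext a = opSum (U.ext a) (V.ext a) := by
  induction a using TwAlg.induction_on with
  | h0 => simp only [map_zero]; rfl
  | hadd a b h h' => simp only [map_add, h, h']; rfl
  | hs r x => simp only [map_smul, SigmaRep.ext_gen, SigmaRep.sum_toFun]; rfl

theorem coeff_sum {G : Type u} [Group G] {σ : NormalizedCocycle G} (U : SigmaRep σ H)
    (V : SigmaRep σ K) (x y : WithLp 2 (H × K)) :
    coeff (U.sum V) x y = coeff U x.fst y.fst + coeff V x.snd y.snd := by
  ext a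
  simp [SigmaRep.sum_ext]

variable {L : Type u} [NonUnitalCStarAlgebra L]

/-- The direct sum of two representations of a C*-algebra. -/
def repSum (π : L →⋆ₙₐ[ℂ] (H →L[ℂ] H)) (ρ : L →⋆ₙₐ[ℂ] (K →L[ℂ] K)) :
    L →⋆ₙₐ[ℂ] (WithLp 2 (H × K) →L[ℂ] WithLp 2 (H × K)) :=
  ((opSumHom H K : _ →⋆ₙₐ[ℂ] _)).comp (π.prod ρ)

@[simp] theorem repSum_apply (π : L →⋆ₙₐ[ℂ] (H →L[ℂ] H)) (ρ : L →⋆ₙₐ[ℂ] (K →L[ℂ] K)) (A : L) :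
    repSum π ρ A = opSum (π A) (ρ A) := rfl

theorem Nondegenerate.sum {π : L →⋆ₙₐ[ℂ] (H →L[ℂ] H)} {ρ : L →⋆ₙₐ[ℂ] (K →L[ℂ] K)}
    (hπ : Nondegenerate π) (hρ : Nondegenerate ρ) : Nondegenerate (repSum π ρ) := by
  set W := (Submodule.span ℂ {v | ∃ A ψ, repSum π ρ A ψ = v}).topologicalClosure with hW
  have hcl : IsClosed (W : Set (WithLp 2 (H × K))) := Submodule.isClosed_topologicalClosure _
  let e := (WithLp.prodContinuousLinearEquiv 2 ℂ H K).symm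
  have h1 : ∀ x : H, e (x, 0) ∈ W := by
    have : (⊤ : Submodule ℂ H) ≤
        W.comap ((e : H × K →L[ℂ] _).comp (ContinuousLinearMap.inl ℂ H K)).toLinearMap := by
      rw [← hπ]
      refine Submodule.topologicalClosure_minimal _ (Submodule.span_le.2 ?_)
        (hcl.preimage (ContinuousLinearMap.continuous _))
      rintro _ ⟨A, ψ, rfl⟩
      refine Submodule.le_topologicalClosure _ (Submodule.subset_span ⟨A, e (ψ, 0), ?_⟩)
      simp [e]
    exact fun x => this Submodule.mem_top
  have h2 : ∀ y : K, e (0, y) ∈ W := by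
    have : (⊤ : Submodule ℂ K) ≤
        W.comap ((e : H × K →L[ℂ] _).comp (ContinuousLinearMap.inr ℂ H K)).toLinearMap := by
      rw [← hρ]
      refine Submodule.topologicalClosure_minimal _ (Submodule.span_le.2 ?_)
        (hcl.preimage (ContinuousLinearMap.continuous _))
      rintro _ ⟨A, ψ, rfl⟩
      refine Submodule.le_topologicalClosure _ (Submodule.subset_span ⟨A, e (0, ψ), ?_⟩)
      simp [e]
    exact fun x => this Submodule.mem_top
  refine (Submodule.eq_top_iff' (p := W)).2 fun x => ?_
  have := W.add_mem (h1 x.fst) (h2 x.snd)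
  rw [← map_add, Prod.mk_add_mk, add_zero, zero_add] at this
  exact this

theorem multExt_sum {π : L →⋆ₙₐ[ℂ] (H →L[ℂ] H)} {ρ : L →⋆ₙₐ[ℂ] (K →L[ℂ] K)}
    (hπ : Nondegenerate π) (hρ : Nondegenerate ρ) (m : 𝓜(ℂ, L)) :
    multExt (repSum π ρ) m = opSum (multExt π m) (multExt ρ m) :=
  ((hπ.sum hρ).eq_multExt fun A ψ => by simp [hπ.multExt_apply, hρ.multExt_apply]).symm

theorem IsTheta.sum {G : Type u} [Group G] {σ : NormalizedCocycle G} {φ : G → unitary 𝓜(ℂ, L)}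
    {π : L →⋆ₙₐ[ℂ] (H →L[ℂ] H)} {ρ : L →⋆ₙₐ[ℂ] (K →L[ℂ] K)} {U : SigmaRep σ H}
    {V : SigmaRep σ K} (hU : IsTheta φ π U) (hV : IsTheta φ ρ V) :
    IsTheta φ (repSum π ρ) (U.sum V) := fun g A ψ => by
  rw [SigmaRep.sum_toFun]
  simp [hU g A, hV g A]

end DirectSum

/-! ### Injectivity of θ and the bicommutant argument -/

section Commutant

variable {G : Type u} [Group G] {σ : NormalizedCocycle G} {L : Type u} [NonUnitalCStarAlgebra L]
  {H : Type u} [NormedAddCommGroup H] [InnerProductSpace ℂ H] [CompleteSpace H]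

/-- The conjugate `W π(·) W*` of a representation by a unitary. -/
def conjRep (W : unitary (H →L[ℂ] H)) (π : L →⋆ₙₐ[ℂ] (H →L[ℂ] H)) : L →⋆ₙₐ[ℂ] (H →L[ℂ] H) where
  toFun A := Unitary.conjStarAlgAut ℂ (H →L[ℂ] H) W (π A)
  map_smul' r A := by simp only [map_smul]; rfl
  map_zero' := by simp only [map_zero]
  map_add' A B := by simp only [map_add]
  map_mul' A B := by simp only [map_mul]
  map_star' A := by simp only [map_star]

theorem conjRep_apply (W : unitary (H →L[ℂ] H)) (π : L →⋆ₙₐ[ℂ] (H →L[ℂ] H)) (A : L) :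
    conjRep W π A = (W : H →L[ℂ] H) * π A * (star W : H →L[ℂ] H) := rfl

theorem Nondegenerate.conjRep {π : L →⋆ₙₐ[ℂ] (H →L[ℂ] H)} (hπ : Nondegenerate π)
    (W : unitary (H →L[ℂ] H)) :
    Nondegenerate (conjRep W π) := by
  set ρ := SigmaGroup.conjRep W π
  set T := (Submodule.span ℂ {v | ∃ A ψ, ρ A ψ = v}).topologicalClosure
  have hcl : IsClosed (T : Set H) := Submodule.isClosed_topologicalClosure _
  have : (⊤ : Submodule ℂ H) ≤ T.comap (W : H →L[ℂ] H).toLinearMap := by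
    rw [← hπ]
    refine Submodule.topologicalClosure_minimal _ (Submodule.span_le.2 ?_)
      (hcl.preimage (W : H →L[ℂ] H).continuous)
    rintro _ ⟨A, ψ, rfl⟩
    refine Submodule.le_topologicalClosure _ (Submodule.subset_span ⟨A, (W : H →L[ℂ] H) ψ, ?_⟩)
    have h1 : ρ A * (W : H →L[ℂ] H) = (W : H →L[ℂ] H) * π A := by
      rw [conjRep_apply, mul_assoc, Unitary.coe_star_mul_self, mul_one]
    exact congrArg (fun S : H →L[ℂ] H => S ψ) h1
  refine (Submodule.eq_top_iff' (p := T)).2 fun x => ?_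
  have h2 : (W : H →L[ℂ] H) ((star W : H →L[ℂ] H) x) = x :=
    congrArg (fun S : H →L[ℂ] H => S x) (Unitary.coe_mul_star_self W)
  rw [← h2]
  exact this Submodule.mem_top

variable {R : RepFamily σ} {φ : G → unitary 𝓜(ℂ, L)}

/-- A unitary intertwiner of `θ(π)` commutes with `π`, because `θ` is injective. -/
theorem IsGroupAlgebra.commute_of_unitary (hL : IsGroupAlgebra R φ)
    {π : L →⋆ₙₐ[ℂ] (H →L[ℂ] H)} {U : SigmaRep σ H} (hπ : Nondegenerate π) (hU : IsTheta φ π U)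
    (W : unitary (H →L[ℂ] H))
    (hW : ∀ g, (W : H →L[ℂ] H) * (U.toFun g : H →L[ℂ] H) = (U.toFun g : H →L[ℂ] H) * W)
    (A : L) : (W : H →L[ℂ] H) * π A = π A * W := by
  -- W π(·) W* has the same image under θ, because W commutes with every U(g).
  have key := hL.injective H _ π U (hπ.conjRep W) hπ (fun g A ψ => by
    have h : (U.toFun g : H →L[ℂ] H) * ((W : H →L[ℂ] H) * π A * (star W : H →L[ℂ] H)) =
        (W : H →L[ℂ] H) * π ((φ g : 𝓜(ℂ, L)).fst A) * (star W : H →L[ℂ] H) := by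
      rw [← mul_assoc, ← mul_assoc, ← hW, mul_assoc (W : H →L[ℂ] H)]
      congr 2
      ext v
      exact hU g A v
    exact congrArg (fun S : H →L[ℂ] H => S ψ) h) hU
  have h1 : (W : H →L[ℂ] H) * π A * (star W : H →L[ℂ] H) = π A :=
    congrArg (fun ρ : L →⋆ₙₐ[ℂ] (H →L[ℂ] H) => ρ A) key
  conv_rhs => rw [← h1]
  rw [mul_assoc _ _ (W : H →L[ℂ] H), Unitary.coe_star_mul_self, mul_one]

/-- Closed subspaces invariant under `θ(π)` are invariant under the multiplier algebra. -/
theorem IsGroupAlgebra.multExt_mem (hL : IsGroupAlgebra R φ)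
    {π : L →⋆ₙₐ[ℂ] (H →L[ℂ] H)} {U : SigmaRep σ H} (hπ : Nondegenerate π) (hU : IsTheta φ π U)
    (V : Submodule ℂ H) (hcl : IsClosed (V : Set H))
    (hV : ∀ g, ∀ x ∈ V, (U.toFun g : H →L[ℂ] H) x ∈ V) (m : 𝓜(ℂ, L)) {x : H} (hx : x ∈ V) :
    multExt π m x ∈ V := by
  have : CompleteSpace V := hcl.completeSpace_coe
  -- Since U(g)* = U(g⁻¹), the complement is invariant too, so the projection onto V commutes with
  -- U.
  have hV' : ∀ g, ∀ x ∈ Vᗮ, (U.toFun g : H →L[ℂ] H) x ∈ Vᗮ := fun g x hx v hv => by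
    have h := hx _ (hV g⁻¹ v hv)
    rwa [U.toFun_inv, ContinuousLinearMap.star_eq_adjoint,
      ContinuousLinearMap.adjoint_inner_left] at h
  set P : H →L[ℂ] H := V.starProjection with hP
  have hPU : ∀ g, P * (U.toFun g : H →L[ℂ] H) = (U.toFun g : H →L[ℂ] H) * P := fun g => by
    ext v
    refine Submodule.eq_starProjection_of_mem_orthogonal (K := V)
      (hV g _ (Submodule.starProjection_apply_mem V v)) ?_
    change (U.toFun g : H →L[ℂ] H) v - (U.toFun g : H →L[ℂ] H) (P v) ∈ Vᗮ
    rw [← map_sub]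
    exact hV' g _ (Submodule.sub_starProjection_mem_orthogonal v)
  have hPs : IsStarProjection P := isStarProjection_starProjection
  -- The reflection 2P − 1 is a unitary in the commutant of U; commuting with it is the same as
  -- commuting with P.
  let W : unitary (H →L[ℂ] H) := ⟨2 * P - 1, hPs.two_mul_sub_one_mem_unitary⟩
  have hPA : ∀ A, P * π A = π A * P := fun A => by
    have h := hL.commute_of_unitary hπ hU W (fun g => by
      change (2 * P - 1) * (U.toFun g : H →L[ℂ] H) = (U.toFun g : H →L[ℂ] H) * (2 * P - 1)
      rw [sub_mul, mul_sub, mul_assoc, hPU, two_mul, two_mul, mul_add, one_mul, mul_one]) A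
    change (2 * P - 1) * π A = π A * (2 * P - 1) at h
    rw [sub_mul, mul_sub, one_mul, mul_one, sub_left_inj, mul_assoc, two_mul, two_mul, mul_add,
      ← two_smul ℂ, ← two_smul ℂ] at h
    exact smul_right_injective _ (two_ne_zero (α := ℂ)) h
  have hPm : P * multExt π m = multExt π m * P := hπ.clm_ext fun A ψ => by
    have h1 : ∀ B v, P (π B v) = π B (P v) := fun B v =>
      congrArg (fun S : H →L[ℂ] H => S v) (hPA B)
    change P (multExt π m (π A ψ)) = multExt π m (P (π A ψ))
    rw [hπ.multExt_apply, h1, h1, hπ.multExt_apply]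
  have h2 : P (multExt π m x) = multExt π m (P x) :=
    congrArg (fun S : H →L[ℂ] H => S x) hPm
  rw [Submodule.starProjection_eq_self_iff.2 hx] at h2
  exact Submodule.starProjection_eq_self_iff.1 h2

/-- The closed cyclic subspace generated by x under U is invariant under the multipliers, and α is
orthogonal to it. -/
theorem IsGroupAlgebra.inner_multExt_eq_zero (hL : IsGroupAlgebra R φ)
    {π : L →⋆ₙₐ[ℂ] (H →L[ℂ] H)} {U : SigmaRep σ H} (hπ : Nondegenerate π) (hU : IsTheta φ π U)
    (m : 𝓜(ℂ, L)) {α x : H} (h : ∀ c : TwAlg σ, inner ℂ α (U.ext c x) = 0) :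
    inner ℂ α (multExt π m x) = 0 := by
  let T : TwAlg σ →ₗ[ℂ] H := (ContinuousLinearMap.apply ℂ H x).toLinearMap ∘ₗ U.ext
  have hT : ∀ c, T c = U.ext c x := fun _ => rfl
  set V := (LinearMap.range T).topologicalClosure
  have hcl : IsClosed (V : Set H) := Submodule.isClosed_topologicalClosure _
  have hV : ∀ g, ∀ y ∈ V, (U.toFun g : H →L[ℂ] H) y ∈ V := fun g => by
    change V ≤ V.comap (U.toFun g : H →L[ℂ] H).toLinearMap
    refine Submodule.topologicalClosure_minimal _ ?_
      (hcl.preimage (U.toFun g : H →L[ℂ] H).continuous)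
    rintro _ ⟨c, rfl⟩
    refine Submodule.le_topologicalClosure _ ⟨gen σ g * c, ?_⟩
    rw [hT, hT, U.ext_mul, U.ext_gen]
    rfl
  have hx : x ∈ V := Submodule.le_topologicalClosure _ ⟨gen σ 1, by
    rw [hT, U.ext_gen, U.toFun_one]; rfl⟩
  have hm := hL.multExt_mem hπ hU V hcl hV m hx
  have hle : V ≤ (innerSL ℂ α).toLinearMap.ker := by
    refine Submodule.topologicalClosure_minimal _ ?_
      (isClosed_singleton.preimage (innerSL ℂ α).continuous)
    rintro _ ⟨c, rfl⟩
    exact h c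
  exact hle hm

/-- Strong-* density of `θ(π)` of the twisted group algebra in the multiplier algebra, at a pair of
vectors. -/
theorem IsGroupAlgebra.exists_approx (hL : IsGroupAlgebra R φ)
    {π : L →⋆ₙₐ[ℂ] (H →L[ℂ] H)} {U : SigmaRep σ H} (hπ : Nondegenerate π) (hU : IsTheta φ π U)
    (m : 𝓜(ℂ, L)) (η ζ : H) {ε : ℝ} (hε : 0 < ε) :
    ∃ c : TwAlg σ, ‖U.ext c η - multExt π m η‖ < ε ∧
      ‖star (U.ext c) ζ - star (multExt π m) ζ‖ < ε := by
  -- The map S ↦ (Sη, S*ζ) is only real linear, so orthogonality is taken in the underlying real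
  -- Hilbert space.
  let _ : InnerProductSpace ℝ (WithLp 2 (H × H)) := InnerProductSpace.rclikeToReal ℂ _
  let E : (H →L[ℂ] H) →ₗ[ℝ] WithLp 2 (H × H) :=
    { toFun := fun S => WithLp.toLp 2 (S η, star S ζ)
      map_add' := fun S T => by rw [star_add]; rfl
      map_smul' := fun r S => by
        rw [star_smul]; rfl }
  let K : Submodule ℝ (WithLp 2 (H × H)) :=
    LinearMap.range (E ∘ₗ (U.ext.restrictScalars ℝ))
  have hmem : E (multExt π m) ∈ K.topologicalClosure := by
    rw [← Submodule.orthogonal_orthogonal_eq_closure]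
    refine (Submodule.mem_orthogonal' _ _).2 fun w hw => ?_
    let z : TwAlg σ → ℂ := fun c => inner ℂ w.fst (U.ext c η) + inner ℂ ζ (U.ext c w.snd)
    have hre : ∀ S : H →L[ℂ] H, inner ℝ (E S) w =
        (inner ℂ w.fst (S η) + inner ℂ ζ (S w.snd)).re := fun S => by
      change (inner ℂ (S η) w.fst + inner ℂ (star S ζ) w.snd).re = _
      rw [ContinuousLinearMap.star_eq_adjoint, ContinuousLinearMap.adjoint_inner_left,
        Complex.add_re, Complex.add_re, ← inner_conj_symm, Complex.conj_re]
    have hz : ∀ c, (z c).re = 0 := fun c => by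
      rw [← hre]
      exact (Submodule.mem_orthogonal _ _).1 hw _ ⟨c, rfl⟩
    -- Replacing c by ic turns the vanishing of the real part into the vanishing of z(c).
    have hzI : ∀ c, z (Complex.I • c) = Complex.I * z c := fun c => by
      simp only [z, map_smul, _root_.smul_apply, inner_smul_right, mul_add]
    have hz0 : ∀ c, z c = 0 := fun c => by
      refine Complex.ext (hz c) ?_
      have := hz (Complex.I • c)
      rw [hzI] at this
      simpa using this
    -- z(c) is the coefficient of U ⊕ U between (w₁, ζ) and (η, w₂): moving S* across the inner
    -- product lets one direct sum handle both vectors.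
    have h := hL.inner_multExt_eq_zero (hπ.sum hπ) (hU.sum hU) m
      (α := WithLp.toLp 2 (w.fst, ζ)) (x := WithLp.toLp 2 (η, w.snd)) (fun c => by
        rw [SigmaRep.sum_ext]
        exact hz0 c)
    rw [multExt_sum hπ hπ] at h
    rw [hre]
    exact congrArg Complex.re h
  obtain ⟨_, ⟨c, rfl⟩, hc⟩ := Metric.mem_closure_iff.1 hmem ε hε
  rw [dist_comm, dist_eq_norm] at hc
  refine ⟨c, lt_of_le_of_lt ?_ hc, lt_of_le_of_lt ?_ hc⟩
  · exact WithLp.norm_fst_le _ (E (U.ext c) - E (multExt π m))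
  · exact WithLp.norm_snd_le _ (E (U.ext c) - E (multExt π m))

end Commutant

/-! ### Kaplansky's density theorem with the universal norm -/

section Kaplansky

section Operator

variable {H : Type u} [NormedAddCommGroup H] [InnerProductSpace ℂ H] [CompleteSpace H]

theorem exists_inverse_one_add (X : H →L[ℂ] H) :
    ∃ E : H →L[ℂ] H, E * (1 + X * star X) = 1 ∧ (1 + X * star X) * E = 1 := by
  have h : IsUnit (1 + X * star X) :=
    CStarAlgebra.isUnit_of_le 1 (le_add_of_nonneg_right (mul_star_self_nonneg X))
  obtain ⟨u, hu⟩ := h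
  exact ⟨↑u⁻¹, by rw [← hu]; simp, by rw [← hu]; simp⟩

/-- Cauchy–Schwarz applied to (z, (1 + XX*)z). With z = Ev, where E inverts 1 + XX*, it gives the
bounds for both E and EX. -/
theorem norm_sq_add_le (X : H →L[ℂ] H) (z : H) :
    ‖z‖ ^ 2 + ‖star X z‖ ^ 2 ≤ ‖z‖ * ‖z + X (star X z)‖ := by
  have h : inner ℂ z (z + X (star X z)) = ((‖z‖ ^ 2 + ‖star X z‖ ^ 2 : ℝ) : ℂ) := by
    rw [inner_add_right, inner_self_eq_norm_sq_to_K, ← ContinuousLinearMap.adjoint_inner_left,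
      ← ContinuousLinearMap.star_eq_adjoint, inner_self_eq_norm_sq_to_K]
    push_cast
    rfl
  have h2 := norm_inner_le_norm (𝕜 := ℂ) z (z + X (star X z))
  rw [h, Complex.norm_real, Real.norm_of_nonneg (by positivity)] at h2
  exact h2

theorem norm_le_one_of_inverse {X E : H →L[ℂ] H} (hE : (1 + X * star X) * E = 1) : ‖E‖ ≤ 1 := by
  refine ContinuousLinearMap.opNorm_le_bound _ zero_le_one fun v => ?_
  have hv : E v + X (star X (E v)) = v := congrArg (fun S : H →L[ℂ] H => S v) hE
  have := norm_sq_add_le X (E v)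
  rw [hv] at this
  by_contra! h
  nlinarith [norm_nonneg (E v), norm_nonneg v, sq_nonneg ‖star X (E v)‖]

theorem two_mul_norm_mul_le_one {X E : H →L[ℂ] H} (hE : (1 + X * star X) * E = 1) : 2 * ‖E * X‖ ≤ 1 := by
  have hs : star E = E := by
    have h := congrArg star hE
    rw [star_mul, star_add, star_mul, star_star, star_one] at h
    calc star E = star E * ((1 + X * star X) * E) := by rw [hE, mul_one]
      _ = E := by rw [← mul_assoc, h, one_mul]
  rw [← norm_star, star_mul, hs]
  suffices ‖star X * E‖ ≤ 1 / 2 by linarith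
  refine ContinuousLinearMap.opNorm_le_bound _ (by norm_num) fun v => ?_
  have hv : E v + X (star X (E v)) = v := congrArg (fun S : H →L[ℂ] H => S v) hE
  have := norm_sq_add_le X (E v)
  rw [hv] at this
  change ‖star X (E v)‖ ≤ _
  refine abs_le_of_sq_le_sq' ?_ (by positivity) |>.2
  -- ‖X*Ev‖² ≤ ‖Ev‖(‖v‖ − ‖Ev‖) ≤ ‖v‖²/4.
  nlinarith [sq_nonneg (2 * ‖E v‖ - ‖v‖)]

theorem norm_smul_one_sub_le (X : H →L[ℂ] H) {M : ℝ} (hM : ‖X‖ ^ 2 ≤ M) :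
    ‖(M : ℂ) • (1 : H →L[ℂ] H) - X * star X‖ ≤ M := by
  have hM0 : 0 ≤ M := (sq_nonneg _).trans hM
  have h1 : X * star X ≤ (M : ℂ) • (1 : H →L[ℂ] H) := by
    refine CStarAlgebra.mul_star_le_algebraMap_norm_sq.trans ?_
    rw [Complex.coe_smul, ← Algebra.algebraMap_eq_smul_one]
    exact algebraMap_mono _ hM
  refine (CStarAlgebra.norm_le_norm_of_nonneg_of_le (sub_nonneg.2 h1)
    (sub_le_self _ (mul_star_self_nonneg X))).trans ?_
  rw [norm_smul, Complex.norm_real, Real.norm_of_nonneg hM0]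
  exact mul_le_of_le_one_right hM0 ContinuousLinearMap.norm_id_le

end Operator

section Polar

variable {A : Type*} [CStarAlgebra A]

/-- A contraction is of the form `2 s (1 + s* s)⁻¹`. -/
theorem exists_two_smul_mul_eq (m : A) (hm : ‖m‖ ≤ 1) :
    ∃ s k : A, m = (2 : ℂ) • (s * k) ∧ (1 + star s * s) * k = 1 := by
  let _ : PartialOrder A := CStarAlgebra.spectralOrder A
  have _ : StarOrderedRing A := CStarAlgebra.spectralOrderedRing A
  have h0 : 0 ≤ 1 - star m * m := by
    refine sub_nonneg.2 (CStarAlgebra.star_mul_le_algebraMap_norm_sq.trans ?_)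
    rw [← map_one (algebraMap ℝ A)]
    exact algebraMap_mono _ (by nlinarith [norm_nonneg m])
  -- The half-angle formula: with m = sin θ and r = cos θ, the choice s = m(1 + r)⁻¹ is tan(θ/2),
  -- and k = (1 + r)/2 inverts 1 + s*s.
  set r := CFC.sqrt (1 - star m * m)
  have hr0 : 0 ≤ r := CFC.sqrt_nonneg _
  have hr : r * r = 1 - star m * m := CFC.sqrt_mul_sqrt_self _ h0
  have hrs : star r = r := (IsSelfAdjoint.of_nonneg hr0).star_eq
  obtain ⟨q, hq⟩ : IsUnit (1 + r) := CStarAlgebra.isUnit_of_le 1 (le_add_of_nonneg_right hr0)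
  have hq1 : (↑q⁻¹ : A) * (1 + r) = 1 := by rw [← hq]; simp
  have hq2 : (1 + r) * (↑q⁻¹ : A) = 1 := by rw [← hq]; simp
  have hqs : star (↑q⁻¹ : A) = ↑q⁻¹ := by
    have h := congrArg star hq2
    rw [star_mul, star_add, hrs, star_one] at h
    calc star (↑q⁻¹ : A) = star (↑q⁻¹ : A) * ((1 + r) * ↑q⁻¹) := by rw [hq2, mul_one]
      _ = ↑q⁻¹ := by rw [← mul_assoc, h, one_mul]
  refine ⟨m * ↑q⁻¹, (2⁻¹ : ℂ) • (1 + r), ?_, ?_⟩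
  · rw [mul_smul_comm, smul_smul, mul_assoc, hq1, mul_one]
    norm_num
  · have h1 : star m * m = (1 + r) * (1 - r) := by
      have : star m * m = 1 - r * r := by rw [hr]; abel
      rw [this]; noncomm_ring
    have h2 : star (m * ↑q⁻¹) * (m * ↑q⁻¹) * (1 + r) = 1 - r := by
      rw [star_mul, hqs, mul_assoc, mul_assoc m, hq1, mul_one, mul_assoc, h1, ← mul_assoc, hq1,
        one_mul]
    rw [mul_smul_comm, add_mul, h2, one_mul, show 1 + r + (1 - r) = (2 : ℂ) • (1 : A) by
      rw [two_smul]; abel, smul_smul]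
    norm_num

end Polar

variable {G : Type u} [Group G] {σ : NormalizedCocycle G}

/-- The iterates of a contraction with fixed point `2 (1 + c c*)⁻¹ c`. -/
def iter (c : TwAlg σ) : ℕ → TwAlg σ
  | 0 => 0
  | n + 1 => iter c n + (((1 + ‖c‖ ^ 2)⁻¹ : ℝ) : ℂ) •
      ((2 : ℂ) • c - iter c n - c * (star c * iter c n))

/-- With M = ‖c‖² and t = (1 + M)⁻¹, one step multiplies the error by 1 − t(1 + XX*) = t(M − XX*),
whose norm is at most M/(1 + M). The rate depends on ‖c‖ alone, hence is uniform over all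
σ-representations. -/
theorem norm_ext_iter_sub_le {H : Type u} [NormedAddCommGroup H] [InnerProductSpace ℂ H]
    [CompleteSpace H] (U : SigmaRep σ H) (c : TwAlg σ) {E : H →L[ℂ] H}
    (hE : (1 + U.ext c * star (U.ext c)) * E = 1) (n : ℕ) :
    ‖U.ext (iter c n) - (2 : ℂ) • (E * U.ext c)‖ ≤ (‖c‖ ^ 2 / (1 + ‖c‖ ^ 2)) ^ n := by
  set X := U.ext c
  set M := ‖c‖ ^ 2 with hM
  have hM0 : 0 ≤ M := by positivity
  set t : ℂ := (((1 + M)⁻¹ : ℝ) : ℂ) with ht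
  set e := (2 : ℂ) • (E * X) with he
  have hXe : (2 : ℂ) • X = e + X * star X * e := by
    rw [he, mul_smul_comm, ← smul_add, ← mul_assoc]
    nth_rw 1 [← one_mul (E * X)]
    rw [← mul_assoc 1, ← add_mul, ← add_mul, hE, one_mul]
  induction n with
  | zero =>
    rw [iter, map_zero, zero_sub, norm_neg, pow_zero, he, norm_smul]
    simpa using two_mul_norm_mul_le_one hE
  | succ n ih =>
    set D := U.ext (iter c n) with hD
    have h1 : U.ext (iter c (n + 1)) - e = (t • ((M : ℂ) • 1 - X * star X)) * (D - e) := by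
      have ht1 : t * M = 1 - t := by
        rw [ht]; push_cast
        have : (1 + (M : ℂ)) ≠ 0 := by exact_mod_cast (by positivity : (1 + M) ≠ 0)
        field_simp
        ring
      have hit : U.ext (iter c (n + 1)) = D + t • ((2 : ℂ) • X - D - X * (star X * D)) := by
        rw [iter, map_add, map_smul, map_sub, map_sub, map_smul, U.ext_mul, U.ext_mul, U.ext_star]
      rw [hit, hXe, smul_sub t ((M : ℂ) • _), smul_smul, ht1, sub_smul, one_smul]
      simp only [smul_add, smul_sub, sub_mul, mul_sub, one_mul, smul_mul_assoc, mul_assoc]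
      abel
    rw [h1]
    refine (norm_mul_le _ _).trans ?_
    rw [pow_succ', norm_smul]
    refine mul_le_mul ?_ ih (norm_nonneg _) (by positivity)
    have h2 : ‖(M : ℂ) • (1 : H →L[ℂ] H) - X * star X‖ ≤ M :=
      norm_smul_one_sub_le X (by
        rw [hM]; exact pow_le_pow_left₀ (norm_nonneg _) (norm_ext_le U c) 2)
    rw [ht, Complex.norm_real, Real.norm_of_nonneg (by positivity), div_eq_inv_mul]
    gcongr

/-- In every σ-representation the limit 2EX is a contraction and the error bound is uniform, so the
bound passes to the supremum defining the universal norm. -/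
theorem norm_iter_le (c : TwAlg σ) (n : ℕ) :
    ‖iter c n‖ ≤ 1 + (‖c‖ ^ 2 / (1 + ‖c‖ ^ 2)) ^ n := by
  refine unorm_le fun H _ _ _ U => ?_
  obtain ⟨E, -, hE⟩ := exists_inverse_one_add (U.ext c)
  have h1 := norm_ext_iter_sub_le U c hE n
  have h2 : ‖(2 : ℂ) • (E * U.ext c)‖ ≤ 1 := by
    rw [norm_smul]
    simpa using two_mul_norm_mul_le_one hE
  calc ‖U.ext (iter c n)‖
      = ‖(2 : ℂ) • (E * U.ext c) + (U.ext (iter c n) - (2 : ℂ) • (E * U.ext c))‖ := by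
        rw [add_sub_cancel]
    _ ≤ _ := (norm_add_le _ _).trans (add_le_add h2 h1)

variable {L : Type u} [NonUnitalCStarAlgebra L] {R : RepFamily σ} {φ : G → unitary 𝓜(ℂ, L)}
  {H : Type u} [NormedAddCommGroup H] [InnerProductSpace ℂ H] [CompleteSpace H]

/-- With m = 2sk and η = π(k)ξ, so that ξ = (1 + S*S)η, strong-* approximation of S = π(s) at just η
and Sη yields an element d, of universal norm at most 1 + δ, with U(d)ξ close to π(m)ξ. -/
theorem IsGroupAlgebra.norm_inner_multExt_le_of_norm_le_one (hL : IsGroupAlgebra R φ)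
    {π : L →⋆ₙₐ[ℂ] (H →L[ℂ] H)} {U : SigmaRep σ H} (hπ : Nondegenerate π) (hU : IsTheta φ π U)
    {m : 𝓜(ℂ, L)} (hm : ‖m‖ ≤ 1) (ψ ξ : H) :
    ‖inner ℂ ψ (multExt π m ξ)‖ ≤ ‖coeff U ψ ξ‖ := by
  obtain ⟨s, k, hsk, hk⟩ := exists_two_smul_mul_eq m hm
  set S := multExt π s with hS
  set η := multExt π k ξ with hη
  have hξ : ξ = η + star S (S η) := by
    have h := congrArg (multExt π) hk
    rw [hπ.multExt_mul, hπ.multExt_add, hπ.multExt_mul, hπ.multExt_star, hπ.multExt_one] at h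
    exact (congrArg (fun T : H →L[ℂ] H => T ξ) h).symm
  have hmξ : multExt π m ξ = (2 : ℂ) • S η := by
    rw [hsk, hπ.multExt_smul, hπ.multExt_mul]
    rfl
  -- The first term pays for ‖d‖ ≤ 1 + δ, the second for ‖π(m)ξ − U(d)ξ‖ ≤ δ(3 + ‖ξ‖).
  set C := ‖coeff U ψ ξ‖ + ‖ψ‖ * (3 + ‖ξ‖) with hC
  have hC0 : 0 ≤ C := by positivity
  have key : ∀ δ : ℝ, 0 < δ → ‖inner ℂ ψ (multExt π m ξ)‖ ≤ ‖coeff U ψ ξ‖ + δ * C := by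
    intro δ hδ
    obtain ⟨c, hc1, hc2⟩ := hL.exists_approx hπ hU s η (S η) hδ
    rw [← hS] at hc1 hc2
    obtain ⟨E, hE', hE⟩ := exists_inverse_one_add (U.ext c)
    have hq : ‖c‖ ^ 2 / (1 + ‖c‖ ^ 2) < 1 := by
      rw [div_lt_one (by positivity)]; linarith
    obtain ⟨n, hn⟩ := exists_pow_lt_of_lt_one hδ hq
    have hd := norm_ext_iter_sub_le U c hE n
    have hdn := norm_iter_le c n
    set d := iter c n
    set X := U.ext c
    have h1 : ‖((2 : ℂ) • (E * X)) ξ - (2 : ℂ) • S η‖ ≤ 3 * δ := by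
      have hE1 : ∀ v, E (v + X (star X v)) = v := fun v =>
        congrArg (fun T : H →L[ℂ] H => T v) hE'
      -- Resolvent identity: insert ξ = (1 + S*S)η in the first term and Sη = E(1 + XX*)Sη in the
      -- second.
      have : ((2 : ℂ) • (E * X)) ξ - (2 : ℂ) • S η =
          (2 : ℂ) • (E (X η - S η)) - (2 : ℂ) • ((E * X) (star X (S η) - star S (S η))) := by
        conv_lhs => rw [← hE1 (S η), hξ]
        change (2 : ℂ) • E (X (η + star S (S η))) - _ = (2 : ℂ) • (E (X η - S η)) -
          (2 : ℂ) • (E (X (star X (S η) - star S (S η))))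
        simp only [map_add, map_sub, smul_add, smul_sub]
        abel
      rw [this]
      refine (norm_sub_le _ _).trans ?_
      rw [norm_smul, norm_smul]
      have e1 : ‖E (X η - S η)‖ ≤ δ := by
        refine (E.le_of_opNorm_le (norm_le_one_of_inverse hE) _).trans ?_
        linarith
      have e2 : ‖(E * X) (star X (S η) - star S (S η))‖ ≤ 1 / 2 * δ := by
        refine ((E * X).le_of_opNorm_le
          (by linarith [two_mul_norm_mul_le_one hE] : ‖E * X‖ ≤ 1 / 2) _).trans ?_
        gcongr
      rw [Complex.norm_two]
      linarith
    have h2 : ‖multExt π m ξ - U.ext d ξ‖ ≤ δ * (3 + ‖ξ‖) := by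
      have e1 : ‖(U.ext d - (2 : ℂ) • (E * X)) ξ‖ ≤ δ * ‖ξ‖ :=
        ContinuousLinearMap.le_of_opNorm_le _ (hd.trans hn.le) ξ
      rw [← norm_neg, hmξ, show -((2 : ℂ) • S η - U.ext d ξ) =
        (U.ext d - (2 : ℂ) • (E * X)) ξ + (((2 : ℂ) • (E * X)) ξ - (2 : ℂ) • S η) by
          rw [_root_.sub_apply]; abel]
      refine (norm_add_le _ _).trans ?_
      linarith
    have h3 : ‖inner ℂ ψ (U.ext d ξ)‖ ≤ ‖coeff U ψ ξ‖ * (1 + δ) :=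
      ((coeff U ψ ξ).le_opNorm d).trans (by gcongr; linarith)
    calc ‖inner ℂ ψ (multExt π m ξ)‖
        = ‖inner ℂ ψ (U.ext d ξ) + inner ℂ ψ (multExt π m ξ - U.ext d ξ)‖ := by
          rw [← inner_add_right, add_sub_cancel]
      _ ≤ ‖coeff U ψ ξ‖ * (1 + δ) + ‖ψ‖ * (δ * (3 + ‖ξ‖)) :=
          (norm_add_le _ _).trans (add_le_add h3 ((norm_inner_le_norm _ _).trans (by gcongr)))
      _ = _ := by rw [hC]; ring
  refine le_of_forall_pos_le_add fun ε hε => (key (ε / (C + 1)) (by positivity)).trans ?_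
  gcongr
  rw [div_mul_eq_mul_div, div_le_iff₀ (by positivity)]
  nlinarith

/-- Kaplansky's density theorem, as a bound for the extension of a coefficient functional to the
multiplier algebra. -/
theorem IsGroupAlgebra.norm_inner_multExt_le (hL : IsGroupAlgebra R φ)
    {π : L →⋆ₙₐ[ℂ] (H →L[ℂ] H)} {U : SigmaRep σ H} (hπ : Nondegenerate π) (hU : IsTheta φ π U)
    (m : 𝓜(ℂ, L)) (ψ ξ : H) :
    ‖inner ℂ ψ (multExt π m ξ)‖ ≤ ‖m‖ * ‖coeff U ψ ξ‖ := by
  by_cases h0 : m = 0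
  · have : multExt π m = 0 := by
      rw [h0]
      simpa using hπ.multExt_smul 0 (0 : 𝓜(ℂ, L))
    rw [this]
    simp [h0]
  have hm : ((‖m‖ : ℝ) : ℂ) ≠ 0 := by simpa using h0
  have h := hL.norm_inner_multExt_le_of_norm_le_one hπ hU (m := ((‖m‖ : ℝ) : ℂ)⁻¹ • m) (by
    rw [norm_smul, norm_inv, Complex.norm_real, norm_norm, inv_mul_cancel₀ (norm_ne_zero_iff.2 h0)])
    ψ ξ
  rw [hπ.multExt_smul, _root_.smul_apply, inner_smul_right, norm_mul, norm_inv, Complex.norm_real,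
    norm_norm] at h
  rwa [inv_mul_le_iff₀ (norm_pos_iff.2 h0)] at h

end Kaplansky

/-! ### States and norming GNS representations -/

section States

open scoped ComplexOrder

section Unital

variable {A : Type*} [CStarAlgebra A]

theorem im_eq_zero_of_unital_contraction {g : StrongDual ℂ A} (hg : ‖g‖ ≤ 1) (h1 : g 1 = 1)
    {a : A} (ha : IsSelfAdjoint a) : (g a).im = 0 := by
  -- Evaluate at a + it, where ‖a + it‖² ≤ ‖a‖² + t². Cancelling t² leaves a bound on an expression
  -- affine in t, which forces Im g(a) = 0.
  have key : ∀ t : ℝ, ((g a).im + t) ^ 2 ≤ ‖a‖ ^ 2 + t ^ 2 := fun t => by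
    have e1 : g (a + (Complex.I * t) • (1 : A)) = g a + Complex.I * t := by
      rw [map_add, map_smul, h1, smul_eq_mul, mul_one]
    have e2 : ‖a + (Complex.I * t) • (1 : A)‖ ^ 2 ≤ ‖a‖ ^ 2 + t ^ 2 := by
      have e3 : star (a + (Complex.I * t) • (1 : A)) * (a + (Complex.I * t) • (1 : A)) =
          a * a + ((t ^ 2 : ℝ) : ℂ) • (1 : A) := by
        rw [star_add, ha.star_eq, star_smul, star_one]
        simp only [add_mul, mul_add, smul_add, smul_mul_assoc, mul_smul_comm, mul_one, one_mul,
          smul_smul]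
        have e4 : star (Complex.I * (t : ℂ)) = -(Complex.I * t) := by simp
        have e5 : Complex.I * (t : ℂ) * -(Complex.I * t) = ((t ^ 2 : ℝ) : ℂ) := by
          push_cast
          linear_combination (-(t : ℂ) ^ 2) * Complex.I_mul_I
        rw [e4, e5, neg_smul]
        abel
      rw [sq, ← CStarRing.norm_star_mul_self, e3]
      refine (norm_add_le _ _).trans ?_
      rw [norm_smul, Complex.norm_real, Real.norm_of_nonneg (sq_nonneg t)]
      refine add_le_add ((norm_mul_le _ _).trans (sq _).ge) ?_
      refine mul_le_of_le_one_right (sq_nonneg t) ?_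
      rcases subsingleton_or_nontrivial A with h | h
      · simp [Subsingleton.elim (1 : A) 0]
      · exact CStarRing.norm_one.le
    have e6 : ‖g a + Complex.I * t‖ ≤ ‖a + (Complex.I * t) • (1 : A)‖ := by
      rw [← e1]
      simpa using g.le_of_opNorm_le hg (a + (Complex.I * t) • (1 : A))
    have e7 : |(g a).im + t| ≤ ‖g a + Complex.I * t‖ := by
      simpa using Complex.abs_im_le_norm (g a + Complex.I * t)
    calc ((g a).im + t) ^ 2 = |(g a).im + t| ^ 2 := (sq_abs _).symm
      _ ≤ ‖a + (Complex.I * t) • (1 : A)‖ ^ 2 :=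
        pow_le_pow_left₀ (abs_nonneg _) (e7.trans e6) 2
      _ ≤ _ := e2
  by_contra hy
  have := key (‖a‖ ^ 2 / (g a).im)
  have h2 : (g a).im * (‖a‖ ^ 2 / (g a).im) = ‖a‖ ^ 2 := by field_simp
  nlinarith [sq_nonneg ‖a‖, (sq_pos_iff.2 hy)]

variable [PartialOrder A] [StarOrderedRing A]

/-- A positive a satisfies ‖‖a‖ − a‖ ≤ ‖a‖, so g(a) lies within ‖a‖ of ‖a‖. -/
theorem apply_nonneg_of_unital_contraction {g : StrongDual ℂ A} (hg : ‖g‖ ≤ 1) (h1 : g 1 = 1)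
    {a : A} (ha : 0 ≤ a) : 0 ≤ (g a).re := by
  have hsa : IsSelfAdjoint a := .of_nonneg ha
  have e1 : ‖algebraMap ℝ A ‖a‖ - a‖ ≤ ‖a‖ := by
    refine (CStarAlgebra.norm_le_norm_of_nonneg_of_le (sub_nonneg.2 hsa.le_algebraMap_norm_self)
      (sub_le_self _ ha)).trans ?_
    rcases subsingleton_or_nontrivial A with h | h
    · simp [Subsingleton.elim (algebraMap ℝ A ‖a‖) 0]
    · simp
  have e2 : g (algebraMap ℝ A ‖a‖ - a) = ‖a‖ - g a := by
    rw [Algebra.algebraMap_eq_smul_one, ← Complex.coe_smul, map_sub, map_smul, h1, smul_eq_mul,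
      mul_one]
  have e3 := (g.le_of_opNorm_le hg _).trans ((one_mul _).trans_le e1)
  rw [e2] at e3
  have e4 := (Complex.abs_re_le_norm _).trans e3
  rw [Complex.sub_re, Complex.ofReal_re] at e4
  linarith [le_abs_self (‖a‖ - (g a).re)]

/-- A state that attains the norm of a given positive element. -/
theorem exists_norming_state [Nontrivial A] {h : A} (hh : 0 ≤ h) :
    ∃ g : StrongDual ℂ A, ‖g‖ ≤ 1 ∧ g 1 = 1 ∧ g h = ‖h‖ := by
  -- Because ‖1 + h‖ is at least 1 + ‖h‖, a functional norming 1 + h must attain its largest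
  -- possible value at both 1 and h.
  have hN : 1 + ‖h‖ ≤ ‖1 + h‖ := by
    have h0 : (1 : A) + h ≤ algebraMap ℝ A ‖1 + h‖ :=
      IsSelfAdjoint.le_algebraMap_norm_self (.of_nonneg (add_nonneg zero_le_one hh))
    have h2 : h ≤ algebraMap ℝ A (‖1 + h‖ - 1) := by
      rw [map_sub, map_one]
      exact le_sub_iff_add_le'.2 h0
    have h3 : (1 : ℝ) ≤ ‖1 + h‖ := by
      have := CStarAlgebra.norm_le_norm_of_nonneg_of_le (zero_le_one (α := A))
        (le_add_of_nonneg_right hh)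
      rwa [CStarRing.norm_one] at this
    have h4 := CStarAlgebra.norm_le_norm_of_nonneg_of_le hh h2
    rw [norm_algebraMap', Real.norm_of_nonneg (sub_nonneg.2 h3)] at h4
    linarith
  have hne : (1 : A) + h ≠ 0 := by
    intro h0
    rw [h0, norm_zero] at hN
    linarith [norm_nonneg h]
  obtain ⟨g, hg, hgh⟩ := exists_dual_vector ℂ (1 + h) (norm_ne_zero_iff.2 hne)
  have b1 : ‖g 1‖ ≤ 1 := by
    simpa [hg] using g.le_opNorm 1
  have b2 : ‖g h‖ ≤ ‖h‖ := by
    simpa [hg] using g.le_opNorm h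
  have hre : (g 1).re + (g h).re = ‖1 + h‖ := by
    rw [← Complex.add_re, ← map_add, hgh]
    simp
  have r1 := (Complex.re_le_norm (g 1)).trans b1
  have r2 := (Complex.re_le_norm (g h)).trans b2
  have eq_of : ∀ {z : ℂ} {r : ℝ}, ‖z‖ ≤ r → z.re = r → z = r := by
    intro z r hz hr
    have h0 : z.re = ‖z‖ := le_antisymm (Complex.re_le_norm z) (hr ▸ hz)
    refine Complex.ext hr ?_
    rw [Complex.ofReal_im]
    exact (Complex.nonneg_iff.1 (Complex.re_eq_norm.1 h0)).2.symm
  refine ⟨g, hg.le, ?_, eq_of b2 (by linarith)⟩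
  simpa using eq_of b1 (by linarith)

end Unital

variable {L : Type u} [NonUnitalCStarAlgebra L]

/-- For an approximate unit e, the class of eb, which is e applied to the class of b, tends to the
class of b, because L → `PreGNS` is continuous. -/
theorem gns_nondegenerate [PartialOrder L] [StarOrderedRing L] (f : L →ₚ[ℂ] ℂ) :
    Nondegenerate (H := f.GNS) f.gnsNonUnitalStarAlgHom := by
  set T := (Submodule.span ℂ {v | ∃ A ψ, f.gnsNonUnitalStarAlgHom A ψ = v}).topologicalClosure
  have hcl : IsClosed (T : Set f.GNS) := Submodule.isClosed_topologicalClosure _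
  have hl := CStarAlgebra.increasingApproximateUnit (A := L)
  have hcont : Continuous (f.toPreGNS : L → f.PreGNS) := by
    obtain ⟨C, hC⟩ := f.exists_norm_apply_le
    refine AddMonoidHomClass.continuous_of_bound f.toPreGNS (Real.sqrt C) fun a => ?_
    have e1 : ‖f.toPreGNS a‖ ^ 2 ≤ C * ‖a‖ ^ 2 := by
      have e2 := congrArg norm (f.preGNS_norm_sq (f.toPreGNS a))
      rw [f.ofPreGNS_toPreGNS, ← Complex.ofReal_pow, Complex.norm_real,
        Real.norm_of_nonneg (sq_nonneg _)] at e2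
      rw [e2]
      refine (hC _).trans ?_
      rw [CStarRing.norm_star_mul_self, sq]
    refine abs_le_of_sq_le_sq' ?_ (by positivity) |>.2
    rwa [mul_pow, Real.sq_sqrt C.coe_nonneg]
  refine (Submodule.eq_top_iff' (p := T)).2 fun x => ?_
  induction x using UniformSpace.Completion.induction_on with
  | hp => exact hcl
  | ih b =>
    have hlim : Tendsto (fun e : L => ((f.toPreGNS (e * f.ofPreGNS b) : f.PreGNS) : f.GNS))
        (CStarAlgebra.approximateUnit L) (𝓝 (b : f.GNS)) :=
      (((UniformSpace.Completion.continuous_coe _).comp hcont).tendsto (f.ofPreGNS b)).comp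
        (hl.tendsto_mul_right _)
    refine hcl.mem_of_tendsto hlim (Eventually.of_forall fun e => ?_)
    refine Submodule.le_topologicalClosure _ (Submodule.subset_span ⟨e, b, ?_⟩)
    simp

/-- Nondegenerate representations are jointly isometric. -/
theorem exists_nondegenerate_norm_le (A : L) (hA : A ≠ 0) :
    ∃ (H : Type u) (_ : NormedAddCommGroup H) (_ : InnerProductSpace ℂ H) (_ : CompleteSpace H)
      (π : L →⋆ₙₐ[ℂ] (H →L[ℂ] H)), Nondegenerate π ∧ ‖A‖ ≤ ‖π A‖ := by
  let _ : PartialOrder L := CStarAlgebra.spectralOrder L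
  have _ : StarOrderedRing L := CStarAlgebra.spectralOrderedRing L
  let _ : PartialOrder 𝓜(ℂ, L) := CStarAlgebra.spectralOrder _
  have _ : StarOrderedRing 𝓜(ℂ, L) := CStarAlgebra.spectralOrderedRing _
  let ι : L →⋆ₙₐ[ℂ] 𝓜(ℂ, L) := DoubleCentralizer.coeHom
  have hι : ∀ B, ‖ι B‖ = ‖B‖ := fun B => by
    rw [← DoubleCentralizer.norm_fst]
    exact ContinuousLinearMap.opNorm_mul_apply ℂ L B
  have hιA : ι A ≠ 0 := by
    rw [← norm_ne_zero_iff, hι]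
    exact norm_ne_zero_iff.2 hA
  have : Nontrivial 𝓜(ℂ, L) := ⟨⟨_, _, hιA⟩⟩
  set h := star (ι A) * ι A with hh
  set N := ‖h‖ with hN
  have hNA : N = ‖A‖ ^ 2 := by rw [hN, hh, CStarRing.norm_star_mul_self, hι, sq]
  have hNpos : 0 < N := by rw [hNA]; exact pow_pos (norm_pos_iff.2 hA) 2
  -- The state is taken on the unital algebra M(L) and later restricted to L, which need not have a
  -- unit.
  obtain ⟨g, hg, hg1, hgh⟩ := exists_norming_state (star_mul_self_nonneg (ι A))
  rw [← hh, ← hN] at hgh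
  have hpos : ∀ b : 𝓜(ℂ, L), 0 ≤ (g (star b * b)).re := fun b =>
    apply_nonneg_of_unital_contraction hg hg1 (star_mul_self_nonneg b)
  have hsa : star h = h := (IsSelfAdjoint.star_mul_self (ι A)).star_eq
  -- Positivity of g at (h − N)² gives the lower bound; likewise below, A(h − N) gives g(h³) ≥ N³.
  have hh2 : (g (h * h)).re = N ^ 2 := by
    refine le_antisymm ?_ ?_
    · refine (Complex.re_le_norm _).trans (((g.le_of_opNorm_le hg _).trans_eq (one_mul _)).trans ?_)
      exact (norm_mul_le _ _).trans (sq _).ge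
    · have := hpos (h - (N : ℂ) • 1)
      rw [show star (h - (N : ℂ) • (1 : 𝓜(ℂ, L))) * (h - (N : ℂ) • 1) =
        h * h - (2 * N : ℂ) • h + (N * N : ℂ) • 1 by
          rw [star_sub, hsa, star_smul, star_one, Complex.star_def, Complex.conj_ofReal]
          simp only [sub_mul, mul_sub, smul_sub, smul_mul_assoc, mul_smul_comm, mul_one, one_mul,
            smul_smul, two_mul, add_smul]
          abel, map_add, map_sub, map_smul, map_smul, hgh, hg1] at this
      simp at this
      nlinarith
  have hh3 : N ^ 3 ≤ (g (h * h * h)).re := by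
    have := hpos (ι A * (h - (N : ℂ) • 1))
    rw [show star (ι A * (h - (N : ℂ) • (1 : 𝓜(ℂ, L)))) * (ι A * (h - (N : ℂ) • 1)) =
        h * h * h - (2 * N : ℂ) • (h * h) + (N * N : ℂ) • h by
          rw [star_mul, star_sub, hsa, star_smul, star_one, Complex.star_def, Complex.conj_ofReal,
            mul_assoc, ← mul_assoc (star (ι A)), ← hh]
          simp only [sub_mul, mul_sub, smul_sub, smul_mul_assoc, mul_smul_comm, mul_one, one_mul,
            smul_smul, two_mul, add_smul, mul_assoc]
          abel, map_add, map_sub, map_smul, map_smul, hgh] at this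
    simp [hh2] at this
    nlinarith
  let f : L →ₚ[ℂ] ℂ := PositiveLinearMap.mk₀
    { toFun := fun B => g (ι B)
      map_add' := fun B C => by simp only [map_add]
      map_smul' := fun r B => by rw [map_smul, map_smul]; rfl } (fun B hB => by
        obtain ⟨C, rfl⟩ := CStarAlgebra.nonneg_iff_eq_star_mul_self.1 hB
        change 0 ≤ g (ι (star C * C))
        rw [map_mul, map_star]
        exact Complex.nonneg_iff.2 ⟨hpos _,
          (im_eq_zero_of_unital_contraction hg hg1 (.star_mul_self _)).symm⟩)
  have hf : ∀ B, f B = g (ι B) := fun _ => rfl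
  refine ⟨f.GNS, inferInstance, inferInstance, inferInstance, f.gnsNonUnitalStarAlgHom,
    gns_nondegenerate f, ?_⟩
  -- The class of A*A replaces the cyclic vector: ‖b‖² = g(h²) = N² and ‖π(A)b‖² = g(h³) ≥ N³, so
  -- ‖π(A)‖² ≥ N = ‖A‖².
  set b := f.toPreGNS (star A * A)
  have hb : ‖(b : f.GNS)‖ ^ 2 = N ^ 2 := by
    have := congrArg Complex.re (f.preGNS_norm_sq b)
    rw [← Complex.ofReal_pow, Complex.ofReal_re, hf, f.ofPreGNS_toPreGNS] at this
    rw [UniformSpace.Completion.norm_coe, this, map_mul ι, map_star ι, map_mul ι, map_star ι,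
      ← hh, hsa, hh2]
  have hAb : N ^ 3 ≤ ‖f.gnsNonUnitalStarAlgHom A (b : f.GNS)‖ ^ 2 := by
    rw [f.gnsNonUnitalStarAlgHom_apply_coe, UniformSpace.Completion.norm_coe,
      f.leftMulMapPreGNS_apply]
    have := congrArg Complex.re (f.preGNS_norm_sq (f.toPreGNS (A * (star A * A))))
    rw [← Complex.ofReal_pow, Complex.ofReal_re, hf, f.ofPreGNS_toPreGNS] at this
    refine hh3.trans_eq (Eq.trans ?_ this.symm)
    congr 2
    simp only [map_mul, map_star, star_mul, star_star, hh, mul_assoc]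
  have h1 := (f.gnsNonUnitalStarAlgHom A).le_opNorm (b : f.GNS)
  have h2 : N * N ^ 2 ≤ ‖f.gnsNonUnitalStarAlgHom A‖ ^ 2 * N ^ 2 := by
    rw [← hb, ← mul_pow, hb]
    refine le_trans ?_ (pow_le_pow_left₀ (norm_nonneg _) h1 2)
    linarith
  have h3 := le_of_mul_le_mul_right h2 (by positivity)
  rw [hNA] at h3
  exact abs_le_of_sq_le_sq' h3 (norm_nonneg _) |>.2

end States

/-! ### The embedding of M(L) in J_σ(R)* -/

section Embedding

variable {G : Type u} [Group G] {σ : NormalizedCocycle G} {R : RepFamily σ}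

theorem coeff_mem_J {H : Type u} [NormedAddCommGroup H] [InnerProductSpace ℂ H] [CompleteSpace H]
    {U : SigmaRep σ H} (hU : U ∈ R H) (ψ ξ : H) : coeff U ψ ξ ∈ J R :=
  B_le_J R (Submodule.subset_span ⟨H, _, _, _, U, ψ, ξ, hU, rfl⟩)

/-- Functionals on `J_σ(R)` that agree on coefficient functions agree. -/
theorem JDual.ext_coeff {ω χ : JDual R}
    (h : ∀ (H : Type u) [NormedAddCommGroup H] [InnerProductSpace ℂ H] [CompleteSpace H]
      (U : SigmaRep σ H) (hU : U ∈ R H) (ψ ξ : H),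
      ω ⟨coeff U ψ ξ, coeff_mem_J hU ψ ξ⟩ = χ ⟨coeff U ψ ξ, coeff_mem_J hU ψ ξ⟩) : ω = χ := by
  ext f
  let T : StrongDual ℂ (J R) := (show StrongDual ℂ (J R) from ω) - (show StrongDual ℂ (J R) from χ)
  have := J_induction (⊥ : Submodule ℂ ℂ) isClosed_singleton (T : J R →ₗ[ℂ] ℂ) T.continuous
    (by
      rintro _ ⟨H, _, _, _, U, ψ, ξ, hU, rfl⟩
      exact (Submodule.mem_bot ℂ).2 (sub_eq_zero.2 (h H U hU ψ ξ))) f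
  exact sub_eq_zero.1 ((Submodule.mem_bot ℂ).1 this)

variable {L : Type u} [NonUnitalCStarAlgebra L] {φ : G → unitary 𝓜(ℂ, L)}

/-- The linear relation between coefficient functions `(ψ, U(·) ξ)` and the values `(ψ, π(m) ξ)`,
where `U = θ(π)`. -/
def multGraph (φ : G → unitary 𝓜(ℂ, L)) (m : 𝓜(ℂ, L)) : Submodule ℂ (FS σ × ℂ) where
  carrier := {p | ∃ (H : Type u) (_ : NormedAddCommGroup H) (_ : InnerProductSpace ℂ H)
    (_ : CompleteSpace H) (π : L →⋆ₙₐ[ℂ] (H →L[ℂ] H)) (U : SigmaRep σ H) (ψ ξ : H),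
    Nondegenerate π ∧ IsTheta φ π U ∧ p = (coeff U ψ ξ, inner ℂ ψ (multExt π m ξ))}
  zero_mem' := by
    refine ⟨PUnit.{u + 1}, inferInstance, inferInstance, inferInstance, 0, SigmaRep.zeroRep σ, 0, 0,
      Subsingleton.elim _ _, fun _ _ _ => rfl, Prod.ext ?_ ?_⟩
    · ext a
      simp
    · simp
  -- The sum of two coefficients is a single coefficient of the direct sum, so no span is needed and
  -- the single-coefficient bound covers the whole relation.
  add_mem' := by
    rintro _ _ ⟨H, _, _, _, π, U, ψ, ξ, hπ, hU, rfl⟩ ⟨K, _, _, _, ρ, V, α, β, hρ, hV, rfl⟩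
    refine ⟨WithLp 2 (H × K), inferInstance, inferInstance, inferInstance, repSum π ρ, U.sum V,
      WithLp.toLp 2 (ψ, α), WithLp.toLp 2 (ξ, β), hπ.sum hρ, hU.sum hV, Prod.ext ?_ ?_⟩
    · rw [coeff_sum]
      rfl
    · rw [multExt_sum hπ hρ]
      rfl
  smul_mem' := by
    rintro r _ ⟨H, _, _, _, π, U, ψ, ξ, hπ, hU, rfl⟩
    refine ⟨H, _, _, _, π, U, ψ, r • ξ, hπ, hU, Prod.ext ?_ ?_⟩
    · ext a
      simp
    · simp

namespace IsGroupAlgebra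

/-- The projection of the relation to `J_σ(R)`. -/
def graphFst (hL : IsGroupAlgebra R φ) (m : 𝓜(ℂ, L)) :
    multGraph (σ := σ) φ m →ₗ[ℂ] J R :=
  ((LinearMap.fst ℂ (FS σ) ℂ).comp (multGraph φ m).subtype).codRestrict (J R) (by
    rintro ⟨_, H, _, _, _, π, U, ψ, ξ, hπ, hU, rfl⟩
    exact coeff_mem_J ((hL.image H U).2 ⟨π, hπ, hU⟩) ψ ξ)

/-- The values of the relation. -/
def graphSnd (σ : NormalizedCocycle G) (φ : G → unitary 𝓜(ℂ, L)) (m : 𝓜(ℂ, L)) :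
    multGraph (σ := σ) φ m →ₗ[ℂ] ℂ :=
  (LinearMap.snd ℂ (FS σ) ℂ).comp (multGraph φ m).subtype

/-- This makes the relation single-valued: a pair whose function vanishes has value 0. -/
theorem norm_graphSnd_le (hL : IsGroupAlgebra R φ) (m : 𝓜(ℂ, L)) (x : multGraph (σ := σ) φ m) :
    ‖graphSnd σ φ m x‖ ≤ ‖m‖ * ‖hL.graphFst m x‖ := by
  obtain ⟨_, H, _, _, _, π, U, ψ, ξ, hπ, hU, rfl⟩ := x
  exact hL.norm_inner_multExt_le hπ hU m ψ ξ

theorem denseRange_graphFst (hL : IsGroupAlgebra R φ) (m : 𝓜(ℂ, L)) :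
    DenseRange (hL.graphFst m) := fun g =>
  J_induction (LinearMap.range (hL.graphFst m)).topologicalClosure
    (Submodule.isClosed_topologicalClosure _) LinearMap.id continuous_id (by
      rintro _ ⟨H, _, _, _, U, ψ, ξ, hU, rfl⟩
      obtain ⟨π, hπ, hθ⟩ := (hL.image H U).1 hU
      exact Submodule.le_topologicalClosure _
        ⟨⟨_, H, _, _, _, π, U, ψ, ξ, hπ, hθ, rfl⟩, rfl⟩) g

/-- The functional on `J_σ(R)` defined by a multiplier. -/
def toJDual (hL : IsGroupAlgebra R φ) (m : 𝓜(ℂ, L)) : JDual R :=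
  show StrongDual ℂ (J R) from (graphSnd σ φ m).extendOfNorm (hL.graphFst m)

theorem norm_toJDual_le (hL : IsGroupAlgebra R φ) (m : 𝓜(ℂ, L)) : ‖hL.toJDual m‖ ≤ ‖m‖ :=
  ContinuousLinearMap.opNorm_le_bound _ (norm_nonneg m)
    (LinearMap.norm_extendOfNorm_apply_le (hL.denseRange_graphFst m) _ (hL.norm_graphSnd_le m))

theorem toJDual_coeff (hL : IsGroupAlgebra R φ) (m : 𝓜(ℂ, L)) {H : Type u} [NormedAddCommGroup H]
    [InnerProductSpace ℂ H] [CompleteSpace H] {π : L →⋆ₙₐ[ℂ] (H →L[ℂ] H)} {U : SigmaRep σ H}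
    (hπ : Nondegenerate π) (hU : IsTheta φ π U) (ψ ξ : H) (h : coeff U ψ ξ ∈ J R) :
    hL.toJDual m ⟨coeff U ψ ξ, h⟩ = inner ℂ ψ (multExt π m ξ) :=
  LinearMap.extendOfNorm_eq (f := graphSnd σ φ m) (hL.denseRange_graphFst m)
    ⟨‖m‖, hL.norm_graphSnd_le m⟩ ⟨_, H, _, _, _, π, U, ψ, ξ, hπ, hU, rfl⟩

/-- A functional on `J_σ(R)` is determined by its values on the coefficients of `θ(Rep L)`. -/
theorem toJDual_eq (hL : IsGroupAlgebra R φ) {m : 𝓜(ℂ, L)} {ω : JDual R}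
    (h : ∀ (H : Type u) [NormedAddCommGroup H] [InnerProductSpace ℂ H] [CompleteSpace H]
      (π : L →⋆ₙₐ[ℂ] (H →L[ℂ] H)) (U : SigmaRep σ H), Nondegenerate π → IsTheta φ π U →
      ∀ (ψ ξ : H) (hm : coeff U ψ ξ ∈ J R),
        inner ℂ ψ (multExt π m ξ) = ω ⟨coeff U ψ ξ, hm⟩) : hL.toJDual m = ω :=
  JDual.ext_coeff fun H _ _ _ U hU ψ ξ => by
    obtain ⟨π, hπ, hθ⟩ := (hL.image H U).1 hU
    rw [hL.toJDual_coeff m hπ hθ]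
    exact h H π U hπ hθ ψ ξ _

/-- `θ(π)` exists for every nondegenerate representation `π`. -/
theorem exists_isTheta (hL : IsGroupAlgebra R φ) {H : Type u} [NormedAddCommGroup H]
    [InnerProductSpace ℂ H] [CompleteSpace H] {π : L →⋆ₙₐ[ℂ] (H →L[ℂ] H)}
    (hπ : Nondegenerate π) : ∃ U : SigmaRep σ H, IsTheta φ π U := by
  let F : 𝓜(ℂ, L) →⋆ₐ[ℂ] (H →L[ℂ] H) :=
    { toFun := multExt π
      map_one' := hπ.multExt_one
      map_mul' := hπ.multExt_mul
      map_zero' := by simpa using hπ.multExt_smul 0 0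
      map_add' := hπ.multExt_add
      commutes' := fun r => by
        rw [Algebra.algebraMap_eq_smul_one, hπ.multExt_smul, hπ.multExt_one,
          Algebra.algebraMap_eq_smul_one]
      map_star' := hπ.multExt_star }
  refine ⟨⟨fun g => ⟨F (φ g : 𝓜(ℂ, L)), Unitary.map_mem F (φ g).2⟩, fun x y => ?_⟩,
    fun g A ψ => hπ.multExt_apply _ A ψ⟩
  change F (φ x : 𝓜(ℂ, L)) * F (φ y : 𝓜(ℂ, L)) = (σ x y : ℂ) • F (φ (x * y) : 𝓜(ℂ, L))
  rw [← _root_.map_mul, hL.map_mul, map_smul]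

/-- The *-homomorphism `Ψ : M(L) → J_σ(R)*`. -/
def Psi (hL : IsGroupAlgebra R φ) : 𝓜(ℂ, L) →⋆ₐ[ℂ] JDual R where
  toFun := hL.toJDual
  map_one' := hL.toJDual_eq fun H _ _ _ π U hπ hU ψ ξ hm => by
    rw [hπ.multExt_one, JDual.one_def, JDual.delta_apply, coeff_apply, U.ext_gen, U.toFun_one]
  map_mul' m n := hL.toJDual_eq fun H _ _ _ π U hπ hU ψ ξ hm => by
    have hR := (hL.image H U).2 ⟨π, hπ, hU⟩
    -- Translating (ψ, U(·)ξ) by Ψ(n) moves π(n) onto ξ, so convolution becomes the product of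
    -- operators.
    have : JDual.trans (hL.toJDual n) ⟨coeff U ψ ξ, hm⟩ =
        ⟨coeff U ψ (multExt π n ξ), coeff_mem_J hR _ _⟩ := by
      refine Subtype.ext (ContinuousLinearMap.ext fun a => ?_)
      change JDual.transFS (hL.toJDual n) ⟨coeff U ψ ξ, hm⟩ a = _
      rw [JDual.transFS_apply, coeff_apply]
      simp only [lam_coeff]
      rw [hL.toJDual_coeff n hπ hU, ContinuousLinearMap.star_eq_adjoint,
        ContinuousLinearMap.adjoint_inner_left]
    rw [JDual.mul_apply, this, hL.toJDual_coeff m hπ hU, hπ.multExt_mul]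
    rfl
  map_zero' := hL.toJDual_eq fun H _ _ _ π U hπ hU ψ ξ hm => by
    have h0 : multExt π (0 : 𝓜(ℂ, L)) = 0 := by simpa using hπ.multExt_smul 0 (0 : 𝓜(ℂ, L))
    rw [h0]
    simp
  map_add' m n := hL.toJDual_eq fun H _ _ _ π U hπ hU ψ ξ hm => by
    rw [JDual.add_apply, hL.toJDual_coeff m hπ hU, hL.toJDual_coeff n hπ hU, hπ.multExt_add,
      _root_.add_apply, inner_add_right]
  commutes' r := hL.toJDual_eq fun H _ _ _ π U hπ hU ψ ξ hm => by
    rw [Algebra.algebraMap_eq_smul_one, Algebra.algebraMap_eq_smul_one, JDual.smul_apply,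
      hπ.multExt_smul, hπ.multExt_one, JDual.one_def, JDual.delta_apply, coeff_apply, U.ext_gen,
      U.toFun_one, _root_.smul_apply, inner_smul_right]
  map_star' m := hL.toJDual_eq fun H _ _ _ π U hπ hU ψ ξ hm => by
    have hR := (hL.image H U).2 ⟨π, hπ, hU⟩
    have : (⟨invol (coeff U ψ ξ), invol_mem R ⟨_, hm⟩⟩ : J R) =
        ⟨coeff U ξ ψ, coeff_mem_J hR _ _⟩ := by
      refine Subtype.ext (ContinuousLinearMap.ext fun a => ?_)
      rw [invol_apply, coeff_apply, coeff_apply, SigmaRep.ext_star, inner_conj_symm,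
        ContinuousLinearMap.star_eq_adjoint, ContinuousLinearMap.adjoint_inner_left]
    rw [JDual.star_apply, this, hL.toJDual_coeff m hπ hU, inner_conj_symm, hπ.multExt_star,
      ContinuousLinearMap.star_eq_adjoint, ContinuousLinearMap.adjoint_inner_right]

@[simp] theorem Psi_apply (hL : IsGroupAlgebra R φ) (m : 𝓜(ℂ, L)) : hL.Psi m = hL.toJDual m := rfl

theorem Psi_map_generator (hL : IsGroupAlgebra R φ) (x : G) :
    hL.Psi (φ x : 𝓜(ℂ, L)) = JDual.delta R x :=
  hL.toJDual_eq fun H _ _ _ π U hπ hU ψ ξ hm => by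
    have : (U.toFun x : H →L[ℂ] H) = multExt π (φ x : 𝓜(ℂ, L)) := hπ.eq_multExt (hU x)
    rw [JDual.delta_apply, coeff_apply, U.ext_gen, this]

/-- The norm of π(m) is a supremum of |(y, π(m)x)| over unit vectors, and the coefficient function
of unit vectors lies in the unit ball of J_σ(R). -/
theorem norm_multExt_le_norm_toJDual (hL : IsGroupAlgebra R φ) {H : Type u} [NormedAddCommGroup H]
    [InnerProductSpace ℂ H] [CompleteSpace H] {π : L →⋆ₙₐ[ℂ] (H →L[ℂ] H)}
    (hπ : Nondegenerate π) (m : 𝓜(ℂ, L)) : ‖multExt π m‖ ≤ ‖hL.toJDual m‖ := by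
  obtain ⟨U, hU⟩ := hL.exists_isTheta hπ
  have hR := (hL.image H U).2 ⟨π, hπ, hU⟩
  refine ContinuousLinearMap.opNorm_le_of_re_inner_le (𝕜 := ℂ) (norm_nonneg _) fun x y hx hy => ?_
  refine (RCLike.re_le_norm _).trans ?_
  rw [norm_inner_symm, ← hL.toJDual_coeff m hπ hU y x (coeff_mem_J hR y x)]
  refine (JDual.le_norm _ _).trans (mul_le_of_le_one_right (norm_nonneg _) ?_)
  simpa [hx, hy] using norm_coeff_le U y x

theorem norm_Psi_coe (hL : IsGroupAlgebra R φ) (A : L) : ‖hL.Psi (A : 𝓜(ℂ, L))‖ = ‖A‖ := by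
  refine le_antisymm ((hL.norm_toJDual_le _).trans_eq ?_) ?_
  · rw [← DoubleCentralizer.norm_fst]
    exact ContinuousLinearMap.opNorm_mul_apply ℂ L A
  · by_cases hA : A = 0
    · rw [hA, norm_zero]
      exact norm_nonneg _
    obtain ⟨H, _, _, _, π, hπ, hle⟩ := exists_nondegenerate_norm_le A hA
    refine hle.trans ?_
    rw [← hπ.multExt_coe]
    exact hL.norm_multExt_le_norm_toJDual hπ _

theorem Psi_injective (hL : IsGroupAlgebra R φ) : Function.Injective hL.Psi := by
  refine (injective_iff_map_eq_zero hL.Psi).2 fun m hm => ?_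
  -- If mA ≠ 0, some nondegenerate π has π(mA) ≠ 0, whereas Ψ(m) = 0 forces π(m) = 0.
  have hfst : m.fst = 0 := by
    ext A
    by_contra hA
    obtain ⟨H, _, _, _, π, hπ, hle⟩ := exists_nondegenerate_norm_le (m.fst A) hA
    have h0 : multExt π m = 0 := by
      have := hL.norm_multExt_le_norm_toJDual hπ m
      rw [← hL.Psi_apply, hm, norm_zero] at this
      exact norm_le_zero_iff.1 this
    have h1 : π (m.fst A) = 0 := by
      ext ψ
      rw [← hπ.multExt_apply, h0]
      rfl
    rw [h1, norm_zero] at hle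
    exact hA (norm_le_zero_iff.1 hle)
  rw [← norm_eq_zero, ← DoubleCentralizer.norm_fst, hfst, norm_zero]

end IsGroupAlgebra

end Embedding

end SigmaGroup

end

theorem theorem3p5 {G : Type u} [Group G] {σ : SigmaGroup.NormalizedCocycle G}
    (R : SigmaGroup.RepFamily σ) {L : Type u} [NonUnitalCStarAlgebra L]
    (φ : G → unitary 𝓜(ℂ, L)) (hL : SigmaGroup.IsGroupAlgebra R φ) :
    ∃ Ψ : 𝓜(ℂ, L) →⋆ₐ[ℂ] SigmaGroup.JDual R,
      Function.Injective Ψ ∧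
      (∀ x : G, Ψ (φ x : 𝓜(ℂ, L)) = SigmaGroup.JDual.delta R x) ∧
      (∀ A : L, ‖Ψ (A : 𝓜(ℂ, L))‖ = ‖A‖) :=
  ⟨hL.Psi, hL.Psi_injective, hL.Psi_map_generator, hL.norm_Psi_coe⟩
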